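/- Let $(\mathcal C,\mathbb E,\mathfrak s)$ be an extriangulated category (in the sense of Nakaoka and Palu) with enough projectives $\mathcal P$ and enough injectives $\mathcal I$. Write $\mathcal C/[\mathcal P]$ and $\mathcal C/[\mathcal I]$ for the quotients of $\mathcal C$ by the ideals of morphisms that factor through an object of $\mathcal P$, respectively of $\mathcal I$. For an additive category $\mathcal D$, let $\operatorname{mod-}\mathcal D$ be the category of finitely presented right $\mathcal D$-modules, i.e. additive functors $F:\mathcal D^{\mathrm{op}}\to \mathrm{Ab}$ admitting an exact sequence $\mathcal D(-,X)\to\mathcal D(-,Y)\to F\to 0$. Let $\mathfrak s\text{-tri}(\mathcal C)$ be the category of $\mathfrak s$-triangles $\delta=(X_1\xrightarrow{f_1}X_2\xrightarrow{f_2}X_3\overset{\rho}{\dashrightarrow})$, whose morphisms from $\delta$ to $\delta'=(Y_1\xrightarrow{g_1}Y_2\xrightarrow{g_2}Y_3\overset{\rho'}{\dashrightarrow})$ are the triples $(\varphi_1,\varphi_2,\varphi_3)$ with $\varphi_2f_1=g_1\varphi_1$, $\varphi_3f_2=g_2\varphi_2$ and $(\varphi_1)_*\rho=\varphi_3^*\rho'$,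 and let $\mathcal R_2$ be its ideal of the morphisms for which $\varphi_3$ factors through $g_2$. The contravariant and the covariant defect of $\delta$ are $$\delta^*=\operatorname{Coker}\bigl(\mathcal C(-,X_2)\xrightarrow{\mathcal C(-,f_2)}\mathcal C(-,X_3)\bigr),\qquad \delta_*=\operatorname{Coker}\bigl(\mathcal C(X_2,-)\xrightarrow{\mathcal C(f_1,-)}\mathcal C(X_1,-)\bigr).$$ (1) There are equivalences of categories $$\mathfrak s\text{-tri}(\mathcal C)/\mathcal R_2\;\simeq\;\operatorname{mod-}(\mathcal C/[\mathcal P])\;\simeq\;\bigl(\operatorname{mod-}(\mathcal C/[\mathcal I])^{\mathrm{op}}\bigr)^{\mathrm{op}}.$$ The equivalence $\mathfrak s\text{-tri}(\mathcal C)/\mathcal R_2\simeq\operatorname{mod-}(\mathcal C/[\mathcal P])$ is given by $\delta\mapsto\delta^*$ and the composite equivalence $\mathfrak s\text{-tri}(\mathcal C)/\mathcal R_2\simeq(\operatorname{mod-}(\mathcal C/[\mathcal I])^{\mathrm{op}})^{\mathrm{op}}$ is given by $\delta\mapsto\delta_*$, naturally in $\delta$ (modules over $\mathcal C/[\mathcal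 P]$ and $(\mathcal C/[\mathcal I])^{\mathrm{op}}$ being viewed as functors on $\mathcal C$). (2) The category $\operatorname{mod-}(\mathcal C/[\mathcal P])$ is abelian and has enough projectives and enough injectives. The modules $\mathcal C/[\mathcal P](-,X)$, $X\in\mathcal C$, are projective, and each projective object is a direct summand of one of them; if $\mathcal C/[\mathcal P]$ is idempotent complete, each projective object is isomorphic to some $\mathcal C/[\mathcal P](-,X)$. The functors $\mathbb E(-,X)$, $X\in\mathcal C$, are (finitely presented) injective modules, and each injective object is a direct summand of one of them; if $\mathcal C/[\mathcal I]$ is idempotent complete, each injective object is isomorphic to some $\mathbb E(-,X)$. (3) The category $\operatorname{mod-}(\mathcal C/[\mathcal I])^{\mathrm{op}}$ is abelian and has enough projectives and enough injectives. The modules $\mathcal C/[\mathcal I](X,-)$, $X\in\mathcal C$, are projective, and each projective object is a direct summand of one of them; if $\mathcal C/[\mathcal I]$ is idempotent complete, each projective object is isomorphic to some $\mathcal C/[\mathcal I](X,-)$. The functors $\mathbb E(X,-)$, $X\in\mathcal C$, are (finitely presented) injective modules, and each injective object is a direct summand of one of them; if $\mathcal C/[\mathcal P]$ is idempotent complete,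 each injective object is isomorphic to some $\mathbb E(X,-)$. -/

import Mathlib

open CategoryTheory CategoryTheory.Limits Opposite

universe v u

namespace Extri

/-! ### Ideal quotients -/

section IdealQuotient

variable {C : Type u} [Category.{v} C] [Preadditive C]

/-- Two parallel morphisms are related when their difference factors through an object of `S`,
i.e. lies in the ideal `[S]`. -/
def idealRel (S : ObjectProperty C) : HomRel C := fun X Y f g =>
  ∃ (P : C) (_ : S P) (p : X ⟶ P) (q : P ⟶ Y), f - g = p ≫ q

variable {S : ObjectProperty C} [HasBinaryBiproducts C]

theorem idealRel_add (hS : ∀ P Q : C, S P → S Q → S (P ⊞ Q))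
    {X Y : C} {f₁ f₂ g₁ g₂ : X ⟶ Y} (hf : idealRel S f₁ f₂) (hg : idealRel S g₁ g₂) :
    idealRel S (f₁ + g₁) (f₂ + g₂) := by
  obtain ⟨P, hP, p, q, h⟩ := hf
  obtain ⟨P', hP', p', q', h'⟩ := hg
  refine ⟨P ⊞ P', hS _ _ hP hP', biprod.lift p p', biprod.desc q q', ?_⟩
  rw [biprod.lift_desc, ← h, ← h']
  abel

theorem idealRel_congruence (hne : ∃ P : C, S P) (hS : ∀ P Q : C, S P → S Q → S (P ⊞ Q)) :
    Congruence (idealRel S) where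
  comp_left {_ _ _} f {g g'} h := by
    obtain ⟨P, hP, p, q, h⟩ := h
    exact ⟨P, hP, f ≫ p, q, by rw [← Preadditive.comp_sub, h, Category.assoc]⟩
  comp_right {_ _ _} {f f'} g h := by
    obtain ⟨P, hP, p, q, h⟩ := h
    exact ⟨P, hP, p, q ≫ g, by rw [← Preadditive.sub_comp, h, Category.assoc]⟩
  equivalence :=
    { refl := fun f => by
        obtain ⟨P, hP⟩ := hne
        exact ⟨P, hP, 0, 0, by simp⟩
      symm := fun {f g} h => by
        obtain ⟨P, hP, p, q, h⟩ := h
        exact ⟨P, hP, -p, q, by rw [Preadditive.neg_comp, ← h]; abel⟩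
      trans := fun {f g k} h h' => by
        obtain ⟨P, hP, p, q, h⟩ := idealRel_add hS h h'
        exact ⟨P, hP, p, q, by rw [← h]; abel⟩ }

end IdealQuotient

/-! ### Finitely presented modules -/

/-- A right `D`-module (an additive functor `Dᵒᵖ ⥤ Ab`) is finitely presented when there is an
exact sequence `D(-, X) ⟶ D(-, Y) ⟶ F ⟶ 0`. -/
def isFinitelyPresented (D : Type u) [Category.{v} D] [Preadditive D] :
    ObjectProperty (Dᵒᵖ ⥤ AddCommGrpCat.{v}) := fun F =>
  F.Additive ∧ ∃ (X Y : D) (f : X ⟶ Y) (p : preadditiveYoneda.obj Y ⟶ F)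
    (w : preadditiveYoneda.map f ≫ p = 0),
      (ShortComplex.mk (preadditiveYoneda.map f) p w).Exact ∧ Epi p

/-- The category `mod-D` of finitely presented right `D`-modules. -/
abbrev FPMod (D : Type u) [Category.{v} D] [Preadditive D] :=
  (isFinitelyPresented D).FullSubcategory

/-! ### Extriangulated categories -/

section Extensions

variable {C : Type u} [Category.{v} C]

/-- The extensions `𝔼(Z, A)` for a bifunctor `𝔼 : Cᵒᵖ × C ⟶ Ab`. -/
abbrev Ext (E : Cᵒᵖ ⥤ C ⥤ AddCommGrpCat.{v}) (Z A : C) : Type v := (E.obj (op Z)).obj A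

/-- The extension `a_* δ`. -/
def push (E : Cᵒᵖ ⥤ C ⥤ AddCommGrpCat.{v}) {Z A A' : C} (a : A ⟶ A') (δ : Ext E Z A) :
    Ext E Z A' :=
  (E.obj (op Z)).map a δ

/-- The extension `c^* δ`. -/
def pull (E : Cᵒᵖ ⥤ C ⥤ AddCommGrpCat.{v}) {Z Z' A : C} (c : Z' ⟶ Z) (δ : Ext E Z A) :
    Ext E Z' A :=
  (E.map c.op).app A δ

end Extensions

/-- An extriangulated structure `(𝔼, 𝔰)` on an additive category `C`. The class `𝔰(δ)` is given by
the predicate `IsTri x y δ`, saying that `A -x→ B -y→ Z` belongs to the equivalence class `𝔰(δ)`: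
the fields `exists_tri`, `tri_of_iso`, `iso_of_tri` say that the sequences realizing `δ` form
exactly one equivalence class. -/
structure Extriangulation (C : Type u) [Category.{v} C] [Preadditive C]
    [HasZeroObject C] [HasBinaryBiproducts C] where
  /-- the bifunctor of extensions -/
  E : Cᵒᵖ ⥤ C ⥤ AddCommGrpCat.{v}
  additive_left : ∀ Z : Cᵒᵖ, (E.obj Z).Additive
  additive_right : ∀ A : C, (E.flip.obj A).Additive
  /-- `A -x→ B -y→ Z -δ⇢` is an `𝔰`-triangle -/
  IsTri : ∀ {A B Z : C}, (A ⟶ B) → (B ⟶ Z) → Ext E Z A → Prop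
  exists_tri : ∀ {A Z : C} (δ : Ext E Z A), ∃ (B : C) (x : A ⟶ B) (y : B ⟶ Z), IsTri x y δ
  tri_of_iso : ∀ {A B B' Z : C} {x : A ⟶ B} {y : B ⟶ Z} {δ : Ext E Z A} (b : B ≅ B'),
    IsTri x y δ → IsTri (x ≫ b.hom) (b.inv ≫ y) δ
  iso_of_tri : ∀ {A B B' Z : C} {x : A ⟶ B} {y : B ⟶ Z} {x' : A ⟶ B'} {y' : B' ⟶ Z}
    {δ : Ext E Z A}, IsTri x y δ → IsTri x' y' δ →
      ∃ b : B ≅ B', x ≫ b.hom = x' ∧ b.hom ≫ y' = y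
  /-- every morphism of extensions is realized by a morphism of sequences -/
  exists_realization : ∀ {A B Z A' B' Z' : C} {x : A ⟶ B} {y : B ⟶ Z} {δ : Ext E Z A}
    {x' : A' ⟶ B'} {y' : B' ⟶ Z'} {δ' : Ext E Z' A'}, IsTri x y δ → IsTri x' y' δ' →
    ∀ (a : A ⟶ A') (c : Z ⟶ Z'), push E a δ = pull E c δ' →
      ∃ b : B ⟶ B', x ≫ b = a ≫ x' ∧ y ≫ c = b ≫ y'
  /-- the split sequence realizes the zero extension -/
  tri_zero : ∀ A Z : C, IsTri (biprod.inl : A ⟶ A ⊞ Z) (biprod.snd : A ⊞ Z ⟶ Z) 0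
  /-- direct sums of sequences realize direct sums of extensions -/
  tri_biprod : ∀ {A B Z A' B' Z' : C} {x : A ⟶ B} {y : B ⟶ Z} {δ : Ext E Z A}
    {x' : A' ⟶ B'} {y' : B' ⟶ Z'} {δ' : Ext E Z' A'}, IsTri x y δ → IsTri x' y' δ' →
    IsTri (biprod.map x x') (biprod.map y y')
      (push E (biprod.inl : A ⟶ A ⊞ A') (pull E (biprod.fst : Z ⊞ Z' ⟶ Z) δ) +
        push E (biprod.inr : A' ⟶ A ⊞ A') (pull E (biprod.snd : Z ⊞ Z' ⟶ Z') δ'))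
  et3 : ∀ {A B Z A' B' Z' : C} {x : A ⟶ B} {y : B ⟶ Z} {δ : Ext E Z A}
    {x' : A' ⟶ B'} {y' : B' ⟶ Z'} {δ' : Ext E Z' A'}, IsTri x y δ → IsTri x' y' δ' →
    ∀ (a : A ⟶ A') (b : B ⟶ B'), x ≫ b = a ≫ x' →
      ∃ c : Z ⟶ Z', y ≫ c = b ≫ y' ∧ push E a δ = pull E c δ'
  et3_op : ∀ {A B Z A' B' Z' : C} {x : A ⟶ B} {y : B ⟶ Z} {δ : Ext E Z A}
    {x' : A' ⟶ B'} {y' : B' ⟶ Z'} {δ' : Ext E Z' A'}, IsTri x y δ → IsTri x' y' δ' →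
    ∀ (b : B ⟶ B') (c : Z ⟶ Z'), y ≫ c = b ≫ y' →
      ∃ a : A ⟶ A', x ≫ b = a ≫ x' ∧ push E a δ = pull E c δ'
  et4 : ∀ {A B Z D F : C} {f : A ⟶ B} {f' : B ⟶ D} {δ : Ext E D A}
    {g : B ⟶ Z} {g' : Z ⟶ F} {δ' : Ext E F B}, IsTri f f' δ → IsTri g g' δ' →
    ∃ (Q : C) (h' : Z ⟶ Q) (d : D ⟶ Q) (e : Q ⟶ F) (δ'' : Ext E Q A),
      f' ≫ d = g ≫ h' ∧ h' ≫ e = g' ∧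
      IsTri (f ≫ g) h' δ'' ∧ IsTri d e (push E f' δ') ∧
      pull E d δ'' = δ ∧ push E f δ'' = pull E e δ'
  et4_op : ∀ {A B Z D F : C} {f' : D ⟶ A} {f : A ⟶ B} {δ : Ext E B D}
    {g' : F ⟶ B} {g : B ⟶ Z} {δ' : Ext E Z F}, IsTri f' f δ → IsTri g' g δ' →
    ∃ (Q : C) (d : D ⟶ Q) (e : Q ⟶ F) (h' : Q ⟶ A) (δ'' : Ext E Z Q),
      d ≫ h' = f' ∧ e ≫ g' = h' ≫ f ∧
      IsTri d e (pull E g' δ) ∧ IsTri h' (f ≫ g) δ'' ∧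
      push E e δ'' = δ' ∧ push E d δ = pull E g δ''

namespace Extriangulation

variable {C : Type u} [Category.{v} C] [Preadditive C] [HasZeroObject C] [HasBinaryBiproducts C]
  (ℰ : Extriangulation C)

/-- Projective objects: those lifting along all `𝔰`-deflations. -/
def projectives : ObjectProperty C := fun P =>
  ∀ ⦃A B Z : C⦄ ⦃x : A ⟶ B⦄ ⦃y : B ⟶ Z⦄ ⦃δ : Ext ℰ.E Z A⦄, ℰ.IsTri x y δ →
    ∀ c : P ⟶ Z, ∃ b : P ⟶ B, b ≫ y = c

/-- Injective objects: those extending along all `𝔰`-inflations. -/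
def injectives : ObjectProperty C := fun I =>
  ∀ ⦃A B Z : C⦄ ⦃x : A ⟶ B⦄ ⦃y : B ⟶ Z⦄ ⦃δ : Ext ℰ.E Z A⦄, ℰ.IsTri x y δ →
    ∀ a : A ⟶ I, ∃ b : B ⟶ I, x ≫ b = a

def HasEnoughProjectives : Prop :=
  ∀ Z : C, ∃ (A P : C) (x : A ⟶ P) (y : P ⟶ Z) (δ : Ext ℰ.E Z A),
    ℰ.IsTri x y δ ∧ ℰ.projectives P

def HasEnoughInjectives : Prop :=
  ∀ A : C, ∃ (I Z : C) (x : A ⟶ I) (y : I ⟶ Z) (δ : Ext ℰ.E Z A),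
    ℰ.IsTri x y δ ∧ ℰ.injectives I

open ZeroObject in
theorem exists_projective : ∃ P : C, ℰ.projectives P :=
  ⟨0, fun _ _ _ _ _ _ _ c => ⟨0, by rw [zero_comp]; exact (isZero_zero C).eq_of_src _ _⟩⟩

open ZeroObject in
theorem exists_injective : ∃ I : C, ℰ.injectives I :=
  ⟨0, fun _ _ _ _ _ _ _ c => ⟨0, by rw [comp_zero]; exact (isZero_zero C).eq_of_tgt _ _⟩⟩

theorem projectives_biprod (P Q : C) (hP : ℰ.projectives P) (hQ : ℰ.projectives Q) :
    ℰ.projectives (P ⊞ Q) := by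
  intro A B Z x y δ h c
  obtain ⟨b, hb⟩ := hP h (biprod.inl ≫ c)
  obtain ⟨b', hb'⟩ := hQ h (biprod.inr ≫ c)
  exact ⟨biprod.desc b b', by ext <;> simp [hb, hb']⟩

theorem injectives_biprod (P Q : C) (hP : ℰ.injectives P) (hQ : ℰ.injectives Q) :
    ℰ.injectives (P ⊞ Q) := by
  intro A B Z x y δ h c
  obtain ⟨b, hb⟩ := hP h (c ≫ biprod.fst)
  obtain ⟨b', hb'⟩ := hQ h (c ≫ biprod.snd)
  exact ⟨biprod.lift b b', by ext <;> simp [hb, hb']⟩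

/-- The stable category `C/[𝒫]`. -/
abbrev ModProj := Quotient (idealRel ℰ.projectives)

/-- The costable category `C/[ℐ]`. -/
abbrev ModInj := Quotient (idealRel ℰ.injectives)

instance : Congruence (idealRel ℰ.projectives) :=
  idealRel_congruence ℰ.exists_projective ℰ.projectives_biprod

instance : Congruence (idealRel ℰ.injectives) :=
  idealRel_congruence ℰ.exists_injective ℰ.injectives_biprod

instance : Preadditive ℰ.ModProj :=
  Quotient.preadditive _ fun _ _ _ _ _ _ h h' => idealRel_add ℰ.projectives_biprod h h'

instance : Preadditive ℰ.ModInj :=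
  Quotient.preadditive _ fun _ _ _ _ _ _ h h' => idealRel_add ℰ.injectives_biprod h h'

/-! ### The category of `𝔰`-triangles and its quotient -/

/-- An `𝔰`-triangle `X₁ -f₁→ X₂ -f₂→ X₃ -δ⇢`. -/
structure STri where
  {X₁ X₂ X₃ : C}
  f₁ : X₁ ⟶ X₂
  f₂ : X₂ ⟶ X₃
  δ : Ext ℰ.E X₃ X₁
  isTri : ℰ.IsTri f₁ f₂ δ

/-- A morphism of `𝔰`-triangles. -/
@[ext]
structure STriHom (X Y : ℰ.STri) where
  φ₁ : X.X₁ ⟶ Y.X₁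
  φ₂ : X.X₂ ⟶ Y.X₂
  φ₃ : X.X₃ ⟶ Y.X₃
  comm₁ : X.f₁ ≫ φ₂ = φ₁ ≫ Y.f₁
  comm₂ : X.f₂ ≫ φ₃ = φ₂ ≫ Y.f₂
  comm₃ : push ℰ.E φ₁ X.δ = pull ℰ.E φ₃ Y.δ

/-- The category `𝔰-tri(C)`. -/
instance : Category.{v} ℰ.STri where
  Hom X Y := ℰ.STriHom X Y
  id X :=
    { φ₁ := 𝟙 _
      φ₂ := 𝟙 _
      φ₃ := 𝟙 _
      comm₁ := by simp
      comm₂ := by simp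
      comm₃ := by simp [push, pull] }
  comp {X Y Z} f g :=
    { φ₁ := f.φ₁ ≫ g.φ₁
      φ₂ := f.φ₂ ≫ g.φ₂
      φ₃ := f.φ₃ ≫ g.φ₃
      comm₁ := by rw [reassoc_of% f.comm₁, g.comm₁, Category.assoc]
      comm₂ := by rw [reassoc_of% f.comm₂, g.comm₂, Category.assoc]
      comm₃ := by
        have h₁ := f.comm₃
        have h₂ := g.comm₃
        simp only [push, pull] at h₁ h₂ ⊢
        rw [Functor.map_comp, op_comp, Functor.map_comp, NatTrans.comp_app,
          ConcreteCategory.comp_apply, ConcreteCategory.comp_apply, h₁, ← h₂]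
        exact (NatTrans.naturality_apply (ℰ.E.map f.φ₃.op) g.φ₁ Y.δ).symm }

variable {ℰ} in
@[simp]
theorem STri.id_φ₁ (X : ℰ.STri) : STriHom.φ₁ (𝟙 X) = 𝟙 X.X₁ := rfl

variable {ℰ} in
@[simp]
theorem STri.id_φ₂ (X : ℰ.STri) : STriHom.φ₂ (𝟙 X) = 𝟙 X.X₂ := rfl

variable {ℰ} in
@[simp]
theorem STri.id_φ₃ (X : ℰ.STri) : STriHom.φ₃ (𝟙 X) = 𝟙 X.X₃ := rfl

variable {ℰ} in
@[simp]
theorem STri.comp_φ₁ {X Y Z : ℰ.STri} (f : X ⟶ Y) (g : Y ⟶ Z) :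
    STriHom.φ₁ (f ≫ g) = STriHom.φ₁ f ≫ STriHom.φ₁ g := rfl

variable {ℰ} in
@[simp]
theorem STri.comp_φ₂ {X Y Z : ℰ.STri} (f : X ⟶ Y) (g : Y ⟶ Z) :
    STriHom.φ₂ (f ≫ g) = STriHom.φ₂ f ≫ STriHom.φ₂ g := rfl

variable {ℰ} in
@[simp]
theorem STri.comp_φ₃ {X Y Z : ℰ.STri} (f : X ⟶ Y) (g : Y ⟶ Z) :
    STriHom.φ₃ (f ≫ g) = STriHom.φ₃ f ≫ STriHom.φ₃ g := rfl

/-- `φ` and `ψ` are related when `φ - ψ` lies in the ideal `ℛ₂`, i.e. when `φ₃ - ψ₃` factors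
through the deflation of the target. -/
def relR₂ : HomRel ℰ.STri := fun X Y φ ψ =>
  ∃ p : X.X₃ ⟶ Y.X₂, STriHom.φ₃ φ - STriHom.φ₃ ψ = p ≫ Y.f₂

instance : Congruence ℰ.relR₂ where
  comp_left {_ _ _} f {g g'} h := by
    obtain ⟨p, hp⟩ := h
    exact ⟨STriHom.φ₃ f ≫ p, by simp [← Preadditive.comp_sub, hp]⟩
  comp_right {_ _ _} {f f'} g h := by
    obtain ⟨p, hp⟩ := h
    refine ⟨p ≫ STriHom.φ₂ g, ?_⟩
    rw [STri.comp_φ₃, STri.comp_φ₃, ← Preadditive.sub_comp, hp, Category.assoc, Category.assoc]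
    exact congrArg (p ≫ ·) (STriHom.comm₂ g)
  equivalence :=
    { refl := fun f => ⟨0, by simp⟩
      symm := fun {f g} h => by
        obtain ⟨p, hp⟩ := h
        exact ⟨-p, by rw [Preadditive.neg_comp, ← hp]; abel⟩
      trans := fun {f g k} h h' => by
        obtain ⟨p, hp⟩ := h
        obtain ⟨q, hq⟩ := h'
        exact ⟨p + q, by rw [Preadditive.add_comp, ← hp, ← hq]; abel⟩ }

/-- The quotient category `𝔰-tri(C)/ℛ₂`. -/
abbrev STriModR₂ := Quotient ℰ.relR₂

/-! ### Defects -/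

/-- The contravariant defect `δ^* = Coker (C(-, X₂) ⟶ C(-, X₃))`, as a functor of the
`𝔰`-triangle. -/
noncomputable def contravariantDefect : ℰ.STri ⥤ (Cᵒᵖ ⥤ AddCommGrpCat.{v}) where
  obj X := cokernel (preadditiveYoneda.map X.f₂)
  map {X Y} φ := cokernel.map _ _ (preadditiveYoneda.map (STriHom.φ₂ φ))
    (preadditiveYoneda.map (STriHom.φ₃ φ))
    (by rw [← Functor.map_comp, ← Functor.map_comp, STriHom.comm₂ φ])
  map_id X := by
    apply coequalizer.hom_ext
    simp
  map_comp f g := by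
    apply coequalizer.hom_ext
    simp

/-- The covariant defect `δ_* = Coker (C(X₂, -) ⟶ C(X₁, -))`; it is contravariant in the
`𝔰`-triangle. -/
noncomputable def covariantDefect : ℰ.STri ⥤ (C ⥤ AddCommGrpCat.{v})ᵒᵖ where
  obj X := op (cokernel (preadditiveCoyoneda.map X.f₁.op))
  map {X Y} φ := (cokernel.map _ _ (preadditiveCoyoneda.map (STriHom.φ₂ φ).op)
    (preadditiveCoyoneda.map (STriHom.φ₁ φ).op)
    (by rw [← Functor.map_comp, ← Functor.map_comp, ← op_comp, ← op_comp,
      STriHom.comm₁ φ])).op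
  map_id X := by
    apply Quiver.Hom.unop_inj
    apply coequalizer.hom_ext
    simp
  map_comp f g := by
    apply Quiver.Hom.unop_inj
    apply coequalizer.hom_ext
    simp

/-! ### Modules over the stable categories, viewed as functors on `C` -/

/-- A finitely presented right `C/[𝒫]`-module, viewed as a functor `Cᵒᵖ ⥤ Ab`. -/
abbrev resProj : FPMod ℰ.ModProj ⥤ (Cᵒᵖ ⥤ AddCommGrpCat.{v}) :=
  (isFinitelyPresented ℰ.ModProj).ι ⋙
    (Functor.whiskeringLeft _ _ _).obj (Quotient.functor (idealRel ℰ.projectives)).op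

/-- A finitely presented right `(C/[ℐ])ᵒᵖ`-module, viewed as a covariant functor on `C/[ℐ]`. -/
abbrev covInj : FPMod (ℰ.ModInj)ᵒᵖ ⥤ (ℰ.ModInj ⥤ AddCommGrpCat.{v}) :=
  (isFinitelyPresented (ℰ.ModInj)ᵒᵖ).ι ⋙ (Functor.whiskeringLeft _ _ _).obj (opOp ℰ.ModInj)

/-- A finitely presented right `(C/[ℐ])ᵒᵖ`-module, viewed as a covariant functor on `C`. -/
abbrev resInj : FPMod (ℰ.ModInj)ᵒᵖ ⥤ (C ⥤ AddCommGrpCat.{v}) :=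
  ℰ.covInj ⋙ (Functor.whiskeringLeft _ _ _).obj (Quotient.functor (idealRel ℰ.injectives))

end Extriangulation

end Extri

/-! A finitely presented functor `F` is recorded by a generator `ξ` and a morphism `f` through which
exactly the morphisms killing `ξ` factor (`Presents`). By Yoneda, maps out of `F` are the elements
killed by `f`, so functors presented by the same `f` are isomorphic (`Presents.nonempty_iso`). Every
comparison of modules below comes down to exhibiting one common presenting morphism.

The defect `δ^*` is presented by `f₂`. A morphism factoring through a projective lifts along `f₂`,
so `δ^*` comes from `C/[𝒫]`. Conversely, let `f : X ⟶ Y` present a module over `C/[𝒫]` and let `y :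
P ⟶ Y` be a deflation from a projective. Then `(f, y)` is a deflation (`exists_tri_desc`) with the
same role as `f` modulo `𝒫`, so the module is a defect. Axiom (ET3)ᵒᵖ makes `δ ↦ δ^*` full, and two
morphisms have the same image exactly when they agree modulo `ℛ₂`. The dual argument applies to
`δ_*` with the same ideal: `φ₃` factors through `g₂` iff `φ₃^*ρ' = (φ₁)_*ρ` vanishes, iff `φ₁`
factors through `f₁` (`relR₂_iff`). Both module categories thus come from one quotient of
`𝔰-tri(C)`, whence the duality.

The stable category has weak kernels and the costable one weak cokernels, so both module categories
are abelian; their projectives are the summands of representables. Injectives come from projectives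
by duality: for an `𝔰`-triangle `X ⟶ I ⟶ Z` with `I` injective, `δ_*` is `C/[ℐ](X, -)` and `δ^*` is
`𝔼(-, X)`, and dually for a projective middle term. -/

namespace Extri

/-! ### Presentations of additive functors by elements -/

section Presents

universe u' v'

variable {J : Type u'} [Category.{v'} J]

/-- The element `ξ` of `F` generates `F`, with relations generated by `f`: this is a
presentation `J(X, -) ⟶ J(Y, -) ⟶ F ⟶ 0`. -/
structure Presents (F : J ⥤ AddCommGrpCat.{v}) {Y X : J} (f : Y ⟶ X) (ξ : F.obj Y) : Prop where
  generates : ∀ {W : J} (η : F.obj W), ∃ g : Y ⟶ W, F.map g ξ = η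
  map_eq_zero_iff : ∀ {W : J} (g : Y ⟶ W), F.map g ξ = 0 ↔ ∃ h : X ⟶ W, g = f ≫ h

theorem map_comp_elem (F : J ⥤ AddCommGrpCat.{v}) {X Y Z : J} (f : X ⟶ Y) (g : Y ⟶ Z)
    (ξ : F.obj X) : F.map (f ≫ g) ξ = F.map g (F.map f ξ) := by
  rw [F.map_comp, ConcreteCategory.comp_apply]

theorem map_id_elem (F : J ⥤ AddCommGrpCat.{v}) {X : J} (ξ : F.obj X) :
    F.map (𝟙 X) ξ = ξ := by
  rw [F.map_id, ConcreteCategory.id_apply]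

theorem map_add_elem [Preadditive J] (F : J ⥤ AddCommGrpCat.{v}) [F.Additive] {X Y : J}
    (f g : X ⟶ Y) (ξ : F.obj X) : F.map (f + g) ξ = F.map f ξ + F.map g ξ := by
  rw [F.map_add]
  rfl

theorem map_sub_elem [Preadditive J] (F : J ⥤ AddCommGrpCat.{v}) [F.Additive] {X Y : J}
    (f g : X ⟶ Y) (ξ : F.obj X) : F.map (f - g) ξ = F.map f ξ - F.map g ξ := by
  rw [F.map_sub]
  rfl

theorem naturality_elem {F G : J ⥤ AddCommGrpCat.{v}} (u : F ⟶ G) {X Y : J} (f : X ⟶ Y)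
    (ξ : F.obj X) : u.app Y (F.map f ξ) = G.map f (u.app X ξ) :=
  NatTrans.naturality_apply u f ξ

theorem comp_app_elem {F G H : J ⥤ AddCommGrpCat.{v}} (u : F ⟶ G) (w : G ⟶ H) {X : J}
    (ξ : F.obj X) : (u ≫ w).app X ξ = w.app X (u.app X ξ) := by
  rw [NatTrans.comp_app, ConcreteCategory.comp_apply]

theorem epi_of_surjective {F G : J ⥤ AddCommGrpCat.{v}} (u : F ⟶ G)
    (h : ∀ W, Function.Surjective (u.app W)) : Epi u :=
  (NatTrans.epi_iff_epi_app u).2 fun W => (AddCommGrpCat.epi_iff_surjective _).2 (h W)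

theorem surjective_of_epi {F G : J ⥤ AddCommGrpCat.{v}} (u : F ⟶ G) [Epi u] (W : J) :
    Function.Surjective (u.app W) :=
  (AddCommGrpCat.epi_iff_surjective _).1 ((NatTrans.epi_iff_epi_app u).1 inferInstance W)

theorem exact_iff_exact_app (S : ShortComplex (J ⥤ AddCommGrpCat.{v})) :
    S.Exact ↔ ∀ (W : J) (x : S.X₂.obj W), S.g.app W x = 0 → ∃ y, S.f.app W y = x := by
  rw [ShortComplex.exact_iff_isZero_homology, Functor.isZero_iff]
  refine forall_congr' fun W => ?_
  have e := S.mapHomologyIso ((evaluation J AddCommGrpCat.{v}).obj W)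
  rw [← evaluation_obj_obj, ← Iso.isZero_iff e, ← ShortComplex.exact_iff_isZero_homology, ShortComplex.ab_exact_iff]
  rfl

namespace Presents

variable {F G : J ⥤ AddCommGrpCat.{v}} {X Y : J} {f : Y ⟶ X} {ξ : F.obj Y}

theorem map_self (h : Presents F f ξ) : F.map f ξ = 0 :=
  (h.map_eq_zero_iff f).2 ⟨𝟙 X, by simp⟩

theorem hom_ext (h : Presents F f ξ) {u w : F ⟶ G} (e : u.app Y ξ = w.app Y ξ) : u = w := by
  ext W η
  obtain ⟨g, rfl⟩ := h.generates η
  rw [naturality_elem, naturality_elem, e]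

/-- The rule `F.map g ξ ↦ G.map g η` is well defined: if `g` and `g'` agree on `ξ`, then `g - g'`
factors through `f`, which kills `η`. -/
theorem exists_hom [Preadditive J] [F.Additive] [G.Additive] (h : Presents F f ξ)
    (η : G.obj Y) (hη : G.map f η = 0) : ∃ u : F ⟶ G, u.app Y ξ = η := by
  have key : ∀ {W : J} {g g' : Y ⟶ W}, F.map g ξ = F.map g' ξ → G.map g η = G.map g' η := by
    intro W g g' e
    have : F.map (g - g') ξ = 0 := by
      rw [map_sub_elem, e, sub_self]
    obtain ⟨k, hk⟩ := (h.map_eq_zero_iff _).1 this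
    have h0 : G.map (g - g') η = 0 := by rw [hk, map_comp_elem, hη, map_zero]
    rw [map_sub_elem] at h0
    exact sub_eq_zero.1 h0
  choose c hc using fun (W : J) (x : F.obj W) => h.generates x
  refine ⟨{ app := fun W => AddCommGrpCat.ofHom (AddMonoidHom.mk' (fun x => G.map (c W x) η) ?_)
            naturality := ?_ }, ?_⟩
  · intro x y
    rw [← map_add_elem]
    apply key
    rw [map_add_elem]
    exact (hc _ _).trans (congrArg₂ (· + ·) (hc _ _).symm (hc _ _).symm)
  · intro W W' a
    ext x
    change G.map (c W' (F.map a x)) η = G.map a (G.map (c W x) η)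
    rw [← map_comp_elem]
    apply key
    rw [hc, map_comp_elem, hc]
  · change G.map (c Y ξ) η = η
    conv_rhs => rw [← map_id_elem G η]
    apply key
    rw [hc, map_id_elem]

/-- Each generator is killed by `f`, so it is the image of the other one; the two maps are inverse
because they are so on generators. -/
theorem nonempty_iso [Preadditive J] [F.Additive] [G.Additive] (h : Presents F f ξ)
    {η : G.obj Y} (h' : Presents G f η) : ∃ e : F ≅ G, e.hom.app Y ξ = η := by
  obtain ⟨u, hu⟩ := h.exists_hom η h'.map_self
  obtain ⟨w, hw⟩ := h'.exists_hom ξ h.map_self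
  refine ⟨⟨u, w, h.hom_ext ?_, h'.hom_ext ?_⟩, hu⟩
  · rw [comp_app_elem, hu, hw, NatTrans.id_app, ConcreteCategory.id_apply]
  · rw [comp_app_elem, hw, hu, NatTrans.id_app, ConcreteCategory.id_apply]

theorem of_iso (h : Presents F f ξ) (e : F ≅ G) : Presents G f (e.hom.app Y ξ) := by
  have inv_hom : ∀ {W} (x : G.obj W), e.hom.app W (e.inv.app W x) = x := fun x => by
    rw [← comp_app_elem, e.inv_hom_id, NatTrans.id_app, ConcreteCategory.id_apply]
  have hom_inv : ∀ {W} (x : F.obj W), e.inv.app W (e.hom.app W x) = x := fun x => by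
    rw [← comp_app_elem, e.hom_inv_id, NatTrans.id_app, ConcreteCategory.id_apply]
  refine ⟨fun {W} η => ?_, fun {W} g => ?_⟩
  · obtain ⟨g, hg⟩ := h.generates (e.inv.app W η)
    exact ⟨g, by rw [← naturality_elem, hg, inv_hom]⟩
  · rw [← h.map_eq_zero_iff, ← naturality_elem]
    refine ⟨fun h0 => ?_, fun h0 => by rw [h0, map_zero]⟩
    rw [← hom_inv (F.map g ξ), h0, map_zero]

/-- Restriction of a presentation along a full functor `π`, when the relation `f` is chosen so
that every morphism killed by `π` factors through it. -/
theorem comp {A : Type*} [Category* A] [Preadditive A] [Preadditive J] (π : A ⥤ J) [π.Additive]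
    [π.Full] {M N : A} {k : M ⟶ N}
    {ζ : F.obj (π.obj M)} (h : Presents F (π.map k) ζ)
    (hk : ∀ {W : A} (g : M ⟶ W), π.map g = 0 → ∃ l : N ⟶ W, g = k ≫ l) :
    Presents (π ⋙ F) k (show (π ⋙ F).obj M from ζ) := by
  refine ⟨fun {W} η => ?_, fun {W} g => ?_⟩
  · obtain ⟨g, hg⟩ := h.generates (W := π.obj W) η
    exact ⟨π.preimage g, by rw [Functor.comp_map, π.map_preimage]; exact hg⟩
  · refine (h.map_eq_zero_iff (π.map g)).trans ⟨?_, ?_⟩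
    · rintro ⟨l, hl⟩
      -- A factorization in `J` lifts only up to a morphism killed by `π`; `hk` absorbs this error.
      obtain ⟨m, hm⟩ := hk (g - k ≫ π.preimage l) (by simp [hl])
      exact ⟨π.preimage l + m, by rw [Preadditive.comp_add, ← hm]; abel⟩
    · rintro ⟨l, rfl⟩
      exact ⟨π.map l, π.map_comp _ _⟩

end Presents

end Presents

/-! ### Exact sequences of representables versus presentations by elements -/

section FinitelyPresented

/-- The identity is a free generator, expressed by the zero relation; its target is taken to be `Y`
again, since `D` need not have a zero object. -/
theorem presents_yoneda {D : Type u} [Category.{v} D] [Preadditive D] (Y : D) :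
    Presents (preadditiveYoneda.obj Y) (0 : op Y ⟶ op Y)
      (show (preadditiveYoneda.obj Y).obj (op Y) from 𝟙 Y) where
  generates {W} η := ⟨Quiver.Hom.op (show W.unop ⟶ Y from η), Category.comp_id (X := W.unop) _⟩
  map_eq_zero_iff {W} g := by
    constructor
    · intro h
      have h' : g.unop ≫ 𝟙 Y = 0 := h
      exact ⟨0, Quiver.Hom.unop_inj (by simpa using h')⟩
    · rintro ⟨l, rfl⟩
      exact (show ((0 : op Y ⟶ op Y) ≫ l).unop ≫ 𝟙 Y = 0 by simp)

theorem presents_coyoneda {D : Type u} [Category.{v} D] [Preadditive D] (Y : D) :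
    Presents (preadditiveCoyoneda.obj (op Y)) (0 : Y ⟶ Y)
      (show (preadditiveCoyoneda.obj (op Y)).obj Y from 𝟙 Y) where
  generates {W} η := ⟨show Y ⟶ W from η, Category.id_comp (Y := W) _⟩
  map_eq_zero_iff {W} g := by
    constructor
    · intro h
      have h' : 𝟙 Y ≫ g = 0 := h
      exact ⟨0, by simpa using h'⟩
    · rintro ⟨l, rfl⟩
      exact (show 𝟙 Y ≫ (0 : Y ⟶ Y) ≫ l = 0 by simp)

section

universe u' v'

variable {J : Type u'} [Category.{v'} J] [Preadditive J] {R S F : J ⥤ AddCommGrpCat.{v}}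
  {X Y : J} {f : Y ⟶ X} {ρ : R.obj Y} {σ : S.obj X}

/-- `R` and `S` are free on `ρ` and `σ`, so they stand for representables of either variance, and
`a` is determined by the morphism `f`. -/
theorem presents_of_exact [R.Additive] (hR : Presents R (0 : Y ⟶ Y) ρ)
    (hS : Presents S (0 : X ⟶ X) σ)
    (a : S ⟶ R) (ha : a.app X σ = R.map f ρ) (p : R ⟶ F) (w : a ≫ p = 0)
    (he : (ShortComplex.mk a p w).Exact) (hp : Epi p) : Presents F f (p.app Y ρ) where
  generates {W} η := by
    obtain ⟨x, rfl⟩ := surjective_of_epi p W η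
    obtain ⟨g, rfl⟩ := hR.generates x
    exact ⟨g, (naturality_elem _ _ _).symm⟩
  map_eq_zero_iff {W} g := by
    rw [← naturality_elem]
    constructor
    · intro h
      obtain ⟨y, hy⟩ := (exact_iff_exact_app _).1 he W _ h
      obtain ⟨k, rfl⟩ := hS.generates y
      have : R.map (g - f ≫ k) ρ = 0 := by
        rw [map_sub_elem, sub_eq_zero, map_comp_elem, ← ha, ← naturality_elem]
        exact hy.symm
      obtain ⟨l, hl⟩ := (hR.map_eq_zero_iff _).1 this
      exact ⟨k, by simpa [sub_eq_zero] using hl⟩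
    · rintro ⟨h, rfl⟩
      rw [map_comp_elem, ← ha, ← naturality_elem, ← comp_app_elem, w]
      rfl

theorem exact_of_presents {ξ : F.obj Y} (h : Presents F f ξ)
    (hR : Presents R (0 : Y ⟶ Y) ρ) (hS : Presents S (0 : X ⟶ X) σ)
    (a : S ⟶ R) (ha : a.app X σ = R.map f ρ) (p : R ⟶ F) (hp : p.app Y ρ = ξ) :
    ∃ w : a ≫ p = 0, (ShortComplex.mk a p w).Exact ∧ Epi p := by
  refine ⟨hS.hom_ext ?_, (exact_iff_exact_app _).2 fun W x hx => ?_,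
    epi_of_surjective p fun W η => ?_⟩
  · rw [comp_app_elem, ha, naturality_elem, hp, h.map_self]
    rfl
  · obtain ⟨g, rfl⟩ := hR.generates x
    have hx' : F.map g ξ = 0 := by rw [← hp, ← naturality_elem]; exact hx
    obtain ⟨k, rfl⟩ := (h.map_eq_zero_iff g).1 hx'
    refine ⟨S.map k σ, ?_⟩
    change a.app W _ = _
    rw [naturality_elem, ha, map_comp_elem]
  · obtain ⟨g, rfl⟩ := h.generates η
    exact ⟨R.map g ρ, by rw [naturality_elem, hp]⟩

theorem presents_cokernel [R.Additive] (hR : Presents R (0 : Y ⟶ Y) ρ)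
    (hS : Presents S (0 : X ⟶ X) σ) (a : S ⟶ R) (ha : a.app X σ = R.map f ρ) :
    Presents (cokernel a) f ((cokernel.π a).app Y ρ) :=
  presents_of_exact hR hS a ha (cokernel.π a) (cokernel.condition a)
    (ShortComplex.exact_of_g_is_cokernel _ (cokernelIsCokernel a)) inferInstance

theorem additive_of_epi [R.Additive] (p : R ⟶ F) [Epi p] : F.Additive where
  map_add {Y' W f g} := by
    ext x
    obtain ⟨x, rfl⟩ := surjective_of_epi p _ x
    change F.map (f + g) _ = F.map f _ + F.map g _
    rw [← naturality_elem, ← naturality_elem, ← naturality_elem, map_add_elem, map_add]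

theorem additive_of_mono [R.Additive] (p : F ⟶ R) [Mono p] : F.Additive where
  map_add {Y' W f g} := by
    ext x
    have := (NatTrans.mono_iff_mono_app p).1 inferInstance W
    apply (AddCommGrpCat.mono_iff_injective _).1 this
    change p.app _ (F.map (f + g) _) = p.app _ (F.map f _ + F.map g _)
    rw [map_add, naturality_elem, naturality_elem, naturality_elem, map_add_elem]

end

variable {D : Type u} [Category.{v} D] [Preadditive D]

theorem presents_cokernel_yoneda {X Y : D} (f : X ⟶ Y) :
    Presents (cokernel (preadditiveYoneda.map f)) f.op
      ((cokernel.π (preadditiveYoneda.map f)).app (op Y)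
        (show (preadditiveYoneda.obj Y).obj (op Y) from 𝟙 Y)) :=
  presents_cokernel (presents_yoneda Y) (presents_yoneda X) _
    (show 𝟙 X ≫ f = f ≫ 𝟙 Y by simp)

theorem presents_cokernel_coyoneda {X Y : D} (f : Y ⟶ X) :
    Presents (cokernel (preadditiveCoyoneda.map f.op)) f
      ((cokernel.π (preadditiveCoyoneda.map f.op)).app Y
        (show (preadditiveCoyoneda.obj (op Y)).obj Y from 𝟙 Y)) :=
  presents_cokernel (presents_coyoneda Y) (presents_coyoneda X) _
    (show f ≫ 𝟙 X = 𝟙 Y ≫ f by simp)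

theorem isFinitelyPresented_iff (F : Dᵒᵖ ⥤ AddCommGrpCat.{v}) :
    isFinitelyPresented D F ↔
      F.Additive ∧ ∃ (X Y : D) (f : X ⟶ Y) (ξ : F.obj (op Y)), Presents F f.op ξ := by
  refine and_congr_right fun hF => ⟨?_, ?_⟩
  · rintro ⟨X, Y, f, p, w, he, hp⟩
    exact ⟨X, Y, f, _, presents_of_exact (presents_yoneda Y) (presents_yoneda X) _
      (show 𝟙 X ≫ f = f ≫ 𝟙 Y by simp) p w he hp⟩
  · rintro ⟨X, Y, f, ξ, h⟩
    obtain ⟨p, hp⟩ := (presents_yoneda Y).exists_hom ξ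
      (by rw [F.map_zero]; rfl)
    exact ⟨X, Y, f, p, exact_of_presents h (presents_yoneda Y) (presents_yoneda X) _
      (show 𝟙 X ≫ f = f ≫ 𝟙 Y by simp) p hp⟩

theorem isFinitelyPresented_cokernel {X Y : D} (f : X ⟶ Y) :
    isFinitelyPresented D (cokernel (preadditiveYoneda.map f)) :=
  (isFinitelyPresented_iff _).2 ⟨additive_of_epi (cokernel.π _), X, Y, f, _,
    presents_cokernel_yoneda f⟩

end FinitelyPresented

/-! ### Finitely presented modules form an abelian category -/

section AbelianFP

/-- Every morphism has a weak kernel. -/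
def HasWeakKernels (D : Type u) [Category.{v} D] [Preadditive D] : Prop :=
  ∀ ⦃X Y : D⦄ (f : X ⟶ Y), ∃ (K : D) (k : K ⟶ X), k ≫ f = 0 ∧
    ∀ ⦃W : D⦄ (g : W ⟶ X), g ≫ f = 0 → ∃ l : W ⟶ K, g = l ≫ k

variable {D : Type u} [Category.{v} D] [Preadditive D]

instance : (isFinitelyPresented D).IsClosedUnderIsomorphisms where
  of_iso {F G} e hF := by
    obtain ⟨hF, X, Y, f, ξ, h⟩ := (isFinitelyPresented_iff F).1 hF
    exact (isFinitelyPresented_iff G).2 ⟨additive_of_epi e.hom, X, Y, f, _, h.of_iso e⟩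

open ZeroObject in
theorem isFinitelyPresented_of_isZero [HasZeroObject D] {F : Dᵒᵖ ⥤ AddCommGrpCat.{v}}
    (hF : IsZero F) : isFinitelyPresented D F := by
  have X : D := 0
  have hz : ∀ (W : Dᵒᵖ) (x : F.obj W), x = 0 := fun W x =>
    (AddCommGrpCat.subsingleton_of_isZero ((Functor.isZero_iff F).1 hF W)).elim _ _
  -- Every morphism out of an object factors through its identity, so `𝟙 X` presents the zero
  -- functor for any `X`.
  refine (isFinitelyPresented_iff F).2 ⟨⟨fun {X Y f g} => ?_⟩, X, X, 𝟙 X, 0,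
    ⟨fun η => ?_, fun {W} g => ⟨fun _ => ⟨g, by simp⟩, fun _ => hz _ _⟩⟩⟩
  · exact ((Functor.isZero_iff F).1 hF _).eq_of_src _ _
  · exact ⟨0, by rw [hz _ η, map_zero]⟩

instance [HasZeroObject D] : (isFinitelyPresented D).ContainsZero where
  exists_zero := ⟨_, isZero_zero _, isFinitelyPresented_of_isZero (isZero_zero _)⟩

section

variable [HasBinaryBiproducts D]

/-- Cyclic submodules are finitely presented. Writing `η` as the image of `ξ` under `a`, a morphism
kills `η` iff its composite with `a` factors through `f`, so `k` is a leg of the weak pullback of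
`a` and `f`, built as a weak kernel. -/
theorem exists_annihilator (hD : HasWeakKernels D) {F : Dᵒᵖ ⥤ AddCommGrpCat.{v}} {X Y : D}
    {f : X ⟶ Y} {ξ : F.obj (op Y)} (h : Presents F f.op ξ) {Z : D} (η : F.obj (op Z)) :
    ∃ (K : D) (k : K ⟶ Z), ∀ {W : Dᵒᵖ} (g : op Z ⟶ W),
      F.map g η = 0 ↔ ∃ l : op K ⟶ W, g = k.op ≫ l := by
  obtain ⟨a, rfl⟩ := h.generates η
  obtain ⟨K, k, hk, hl⟩ := hD (biprod.desc a.unop (-f))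
  refine ⟨K, k ≫ biprod.fst, fun {W} g => ?_⟩
  rw [← map_comp_elem, h.map_eq_zero_iff]
  constructor
  · rintro ⟨b, hb⟩
    obtain ⟨l, hl⟩ := hl (biprod.lift g.unop b.unop) (by
      have := congrArg Quiver.Hom.unop hb
      simp only [unop_comp, Quiver.Hom.unop_op] at this
      simp [this])
    refine ⟨l.op, Quiver.Hom.unop_inj ?_⟩
    have := hl =≫ biprod.fst
    simpa using this
  · rintro ⟨l, rfl⟩
    refine ⟨(k ≫ biprod.snd).op ≫ l, Quiver.Hom.unop_inj ?_⟩
    have : k ≫ biprod.fst ≫ a.unop = k ≫ biprod.snd ≫ f := by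
      rw [biprod.desc_eq] at hk
      simpa [Preadditive.comp_add, ← sub_eq_add_neg, sub_eq_zero] using hk
    simp [this]

/-- Annihilators are used twice: that of `u ξ` in the target supplies a generator of the kernel, and
that of this generator, computed in the source, supplies the relations. -/
theorem isClosedUnderKernels (hD : HasWeakKernels D) :
    (isFinitelyPresented D).IsClosedUnderKernels where
  kernels_le := by
    rintro _ ⟨u, k, hk, hM, hN⟩
    rename_i M N
    obtain ⟨hMa, X, Y, f, ξ, hξ⟩ := (isFinitelyPresented_iff M).1 hM
    obtain ⟨hNa, X', Y', f', ξ', hξ'⟩ := (isFinitelyPresented_iff N).1 hN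
    have : Mono k.ι := Fork.IsLimit.mono hk
    have hinj : ∀ {W} {x y : k.pt.obj W}, k.ι.app W x = k.ι.app W y → x = y := fun {W} {x y} h =>
      (AddCommGrpCat.mono_iff_injective _).1
        ((NatTrans.mono_iff_mono_app k.ι).1 inferInstance W) h
    have hex : ∀ {W} (x : M.obj W), u.app W x = 0 → ∃ y, k.ι.app W y = x := fun {W} x hx =>
      (exact_iff_exact_app (ShortComplex.mk k.ι u k.condition)).1
        (ShortComplex.exact_of_f_is_kernel _ (IsLimit.ofIsoLimit hk (Fork.ext (Iso.refl _)))) W x hx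
    have hz : ∀ {W} (x : k.pt.obj W), u.app W (k.ι.app W x) = 0 := fun {W} x => by
      rw [← comp_app_elem, k.condition]
      rfl
    obtain ⟨K₁, k₁, hk₁⟩ := exists_annihilator hD hξ' (u.app _ ξ)
    obtain ⟨lam, hlam⟩ := hex (M.map k₁.op ξ) (by
      rw [naturality_elem, hk₁]
      exact ⟨𝟙 _, by simp⟩)
    obtain ⟨K₂, k₂, hk₂⟩ := exists_annihilator hD hξ (M.map k₁.op ξ)
    refine (isFinitelyPresented_iff _).2 ⟨additive_of_mono k.ι, K₂, K₁, k₂, lam,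
      fun {W} x => ?_, fun {W} g => ?_⟩
    · obtain ⟨g, hg⟩ := hξ.generates (k.ι.app W x)
      have hg0 : N.map g (u.app _ ξ) = 0 := by rw [← naturality_elem, hg, hz]
      obtain ⟨l, rfl⟩ := (hk₁ g).1 hg0
      exact ⟨l, hinj (by rw [naturality_elem, hlam, ← map_comp_elem, hg])⟩
    · rw [← hk₂, ← hlam, ← naturality_elem]
      exact ⟨fun h => by rw [h, map_zero], fun h => hinj (by rw [h, map_zero])⟩

/-- The generator of the target is kept and the image of the generator of the source joins its
relations, so no weak kernels are needed. -/
instance isClosedUnderCokernels : (isFinitelyPresented D).IsClosedUnderCokernels where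
  cokernels_le := by
    rintro _ ⟨u, q, hq, hM, hN⟩
    rename_i M N
    obtain ⟨hMa, X, Y, f, ξ, hξ⟩ := (isFinitelyPresented_iff M).1 hM
    obtain ⟨hNa, X', Y', f', ξ', hξ'⟩ := (isFinitelyPresented_iff N).1 hN
    have : Epi q.π := Cofork.IsColimit.epi hq
    have hex : ∀ {W} (x : N.obj W), q.π.app W x = 0 → ∃ y, u.app W y = x := fun {W} x hx =>
      (exact_iff_exact_app (ShortComplex.mk u q.π q.condition)).1
        (ShortComplex.exact_of_g_is_cokernel _
          (IsColimit.ofIsoColimit hq (Cofork.ext (Iso.refl _)))) W x hx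
    have hz : ∀ {W} (x : M.obj W), q.π.app W (u.app W x) = 0 := fun {W} x => by
      rw [← comp_app_elem, q.condition]
      rfl
    obtain ⟨a, ha⟩ := hξ'.generates (u.app _ ξ)
    refine (isFinitelyPresented_iff _).2 ⟨additive_of_epi q.π, Y ⊞ X', Y',
      biprod.desc a.unop f', q.π.app _ ξ', fun {W} x => ?_, fun {W} g => ?_⟩
    · obtain ⟨x, rfl⟩ := surjective_of_epi q.π W x
      obtain ⟨g, rfl⟩ := hξ'.generates x
      exact ⟨g, (naturality_elem _ _ _).symm⟩
    · rw [← naturality_elem]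
      constructor
      · intro h
        obtain ⟨x, hx⟩ := hex _ h
        obtain ⟨b, rfl⟩ := hξ.generates x
        rw [naturality_elem, ← ha, ← map_comp_elem] at hx
        obtain ⟨l, hl⟩ := (hξ'.map_eq_zero_iff (g - a ≫ b)).1 (by rw [map_sub_elem, hx, sub_self])
        refine ⟨(biprod.lift b.unop l.unop).op, Quiver.Hom.unop_inj ?_⟩
        have := congrArg Quiver.Hom.unop (sub_eq_iff_eq_add.1 hl)
        rw [this]
        simp [add_comm]
      · rintro ⟨l, rfl⟩
        have : (biprod.desc a.unop f').op ≫ l =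
            a ≫ (biprod.fst : Y ⊞ X' ⟶ Y).op ≫ l +
              f'.op ≫ (biprod.snd : Y ⊞ X' ⟶ X').op ≫ l :=
          Quiver.Hom.unop_inj (by simp [biprod.desc_eq])
        rw [this, map_add_elem, map_add, map_comp_elem N f'.op, hξ'.map_self, map_zero, map_zero,
          add_zero, map_comp_elem N a, ha, ← naturality_elem, hz]

theorem isFinitelyPresented_biprod {M N : Dᵒᵖ ⥤ AddCommGrpCat.{v}}
    (hM : isFinitelyPresented D M) (hN : isFinitelyPresented D N) :
    isFinitelyPresented D (M ⊞ N) := by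
  obtain ⟨hMa, X, Y, f, ξ, hξ⟩ := (isFinitelyPresented_iff M).1 hM
  obtain ⟨hNa, X', Y', f', ξ', hξ'⟩ := (isFinitelyPresented_iff N).1 hN
  have ext : ∀ {W} {x y : (M ⊞ N).obj W},
      (biprod.fst : M ⊞ N ⟶ M).app W x = (biprod.fst : M ⊞ N ⟶ M).app W y →
      (biprod.snd : M ⊞ N ⟶ N).app W x = (biprod.snd : M ⊞ N ⟶ N).app W y → x = y := by
    intro W x y h₁ h₂
    have key : ∀ z : (M ⊞ N).obj W, z = (biprod.inl : M ⟶ M ⊞ N).app W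
        ((biprod.fst : M ⊞ N ⟶ M).app W z) + (biprod.inr : N ⟶ M ⊞ N).app W
        ((biprod.snd : M ⊞ N ⟶ N).app W z) := fun z =>
      (congrArg (fun u : M ⊞ N ⟶ M ⊞ N => u.app W z) (biprod.total (X := M) (Y := N))).symm
    rw [key x, key y, h₁, h₂]
  have lift : ∀ {W} (x : M.obj W) (y : N.obj W), ∃ z : (M ⊞ N).obj W,
      (biprod.fst : M ⊞ N ⟶ M).app W z = x ∧ (biprod.snd : M ⊞ N ⟶ N).app W z = y := by
    intro W x y
    refine ⟨(biprod.inl : M ⟶ M ⊞ N).app W x + (biprod.inr : N ⟶ M ⊞ N).app W y, ?_, ?_⟩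
    · rw [map_add, ← comp_app_elem, ← comp_app_elem, biprod.inl_fst, biprod.inr_fst]
      exact add_zero _
    · rw [map_add, ← comp_app_elem, ← comp_app_elem, biprod.inl_snd, biprod.inr_snd]
      exact zero_add _
  obtain ⟨θ, h₁, h₂⟩ := lift (M.map (biprod.fst : Y ⊞ Y' ⟶ Y).op ξ)
    (N.map (biprod.snd : Y ⊞ Y' ⟶ Y').op ξ')
  have hfst : ∀ {W} (g : op (Y ⊞ Y') ⟶ W), (biprod.fst : M ⊞ N ⟶ M).app W ((M ⊞ N).map g θ) =
      M.map ((biprod.fst : Y ⊞ Y' ⟶ Y).op ≫ g) ξ := fun g => by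
    rw [naturality_elem, h₁, map_comp_elem]
  have hsnd : ∀ {W} (g : op (Y ⊞ Y') ⟶ W), (biprod.snd : M ⊞ N ⟶ N).app W ((M ⊞ N).map g θ) =
      N.map ((biprod.snd : Y ⊞ Y' ⟶ Y').op ≫ g) ξ' := fun g => by
    rw [naturality_elem, h₂, map_comp_elem]
  refine (isFinitelyPresented_iff _).2 ⟨⟨fun {V W a b} => ?_⟩, X ⊞ X', Y ⊞ Y', biprod.map f f', θ,
    fun {W} η => ?_, fun {W} g => ?_⟩
  · ext x
    change (M ⊞ N).map (a + b) x = (M ⊞ N).map a x + (M ⊞ N).map b x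
    apply ext <;> rw [map_add, naturality_elem, naturality_elem, naturality_elem, map_add_elem]
  · obtain ⟨a, ha⟩ := hξ.generates ((biprod.fst : M ⊞ N ⟶ M).app W η)
    obtain ⟨b, hb⟩ := hξ'.generates ((biprod.snd : M ⊞ N ⟶ N).app W η)
    refine ⟨(biprod.lift a.unop b.unop).op, ext ?_ ?_⟩
    · rw [hfst, ← ha, ← op_comp, biprod.lift_fst, Quiver.Hom.op_unop]
    · rw [hsnd, ← hb, ← op_comp, biprod.lift_snd, Quiver.Hom.op_unop]
  · have : (M ⊞ N).map g θ = 0 ↔ M.map ((biprod.fst : Y ⊞ Y' ⟶ Y).op ≫ g) ξ = 0 ∧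
        N.map ((biprod.snd : Y ⊞ Y' ⟶ Y').op ≫ g) ξ' = 0 := by
      rw [← hfst, ← hsnd]
      exact ⟨fun h => by rw [h, map_zero, map_zero]; exact ⟨rfl, rfl⟩,
        fun h => ext (by rw [h.1, map_zero]) (by rw [h.2, map_zero])⟩
    rw [this, hξ.map_eq_zero_iff, hξ'.map_eq_zero_iff]
    constructor
    · rintro ⟨⟨a, ha⟩, ⟨b, hb⟩⟩
      refine ⟨(biprod.lift a.unop b.unop).op, Quiver.Hom.unop_inj ?_⟩
      have ha' := congrArg Quiver.Hom.unop ha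
      have hb' := congrArg Quiver.Hom.unop hb
      apply biprod.hom_ext
      · simpa using ha'
      · simpa using hb'
    · rintro ⟨l, rfl⟩
      exact ⟨⟨(biprod.fst : X ⊞ X' ⟶ X).op ≫ l, Quiver.Hom.unop_inj (by simp)⟩,
        ⟨(biprod.snd : X ⊞ X' ⟶ X').op ≫ l, Quiver.Hom.unop_inj (by simp)⟩⟩

instance [HasZeroObject D] : (isFinitelyPresented D).IsClosedUnderFiniteProducts := by
  have : (isFinitelyPresented D).IsClosedUnderBinaryProducts := ⟨by
    rintro F ⟨p⟩
    let e : F ≅ p.diag.obj ⟨WalkingPair.left⟩ ⊞ p.diag.obj ⟨WalkingPair.right⟩ :=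
      IsLimit.conePointsIsoOfNatIso p.isLimit (BinaryBiproduct.isLimit _ _)
        (diagramIsoPair p.diag)
    exact (isFinitelyPresented D).prop_of_iso e.symm
      (isFinitelyPresented_biprod (p.prop_diag_obj _) (p.prop_diag_obj _))⟩
  exact ObjectProperty.IsClosedUnderFiniteProducts.mk'

theorem nonempty_abelian [HasZeroObject D] (hD : HasWeakKernels D) :
    Nonempty (Abelian (FPMod D)) := by
  have := isClosedUnderKernels hD
  exact ⟨inferInstance⟩

end

end AbelianFP

/-! ### Projective finitely presented modules -/

section ProjectiveFP

variable {D : Type u} [Category.{v} D] [Preadditive D]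

theorem isFinitelyPresented_yoneda (Y : D) :
    isFinitelyPresented D (preadditiveYoneda.obj Y) :=
  (isFinitelyPresented_iff _).2 ⟨inferInstance, Y, Y, 0, _, presents_yoneda Y⟩

/-- The representable module `D(-, Y)`. -/
noncomputable abbrev representable (Y : D) : FPMod D :=
  ⟨preadditiveYoneda.obj Y, isFinitelyPresented_yoneda Y⟩

theorem exists_epi_representable (M : FPMod D) :
    ∃ (Y : D) (p : representable Y ⟶ M), Epi p := by
  obtain ⟨hM, X, Y, f, p, w, he, hp⟩ := M.property
  exact ⟨Y, ObjectProperty.homMk p,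
    (isFinitelyPresented D).ι.epi_of_epi_map (by exact hp)⟩

theorem exists_retract_representable (M : FPMod D) [Projective M] :
    ∃ Y : D, Nonempty (Retract M (representable Y)) := by
  obtain ⟨Y, p, hp⟩ := exists_epi_representable M
  exact ⟨Y, ⟨⟨Projective.factorThru (𝟙 M) p, p, Projective.factorThru_comp _ _⟩⟩⟩

/-- The idempotent of `D(-, Y)` that cuts out `M` comes, by Yoneda, from an idempotent of `Y`; its
splitting represents `M`. -/
theorem exists_iso_representable [IsIdempotentComplete D] (M : FPMod D) [Projective M] :
    ∃ Y : D, Nonempty (M ≅ representable Y) := by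
  obtain ⟨Y, ⟨r⟩⟩ := exists_retract_representable M
  obtain ⟨e, he⟩ := preadditiveYoneda.map_surjective (r.r.hom ≫ r.i.hom)
  have hri : r.i.hom ≫ r.r.hom = 𝟙 M.obj := congrArg (·.hom) r.retract
  have hee : e ≫ e = e := preadditiveYoneda.map_injective (by
    rw [Functor.map_comp, he, Category.assoc, reassoc_of% hri])
  obtain ⟨Z, i, p, hip, hpi⟩ := IsIdempotentComplete.idempotents_split Y e hee
  refine ⟨Z, ⟨ObjectProperty.isoMk _ ⟨r.i.hom ≫ preadditiveYoneda.map p,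
    preadditiveYoneda.map i ≫ r.r.hom, ?_, ?_⟩⟩⟩
  · rw [Category.assoc, ← Functor.map_comp_assoc, hpi, he, Category.assoc, hri, Category.comp_id,
      hri]
  · rw [Category.assoc, ← reassoc_of% he, ← Functor.map_comp, ← Functor.map_comp, ← hpi,
      Category.assoc, hip, Category.comp_id, hip, CategoryTheory.Functor.map_id]

variable [HasZeroObject D] [HasBinaryBiproducts D]

/-- Cokernels of finitely presented modules are computed among all functors, so an epimorphism in
the subcategory remains one in the functor category. -/
theorem FPMod.surjective_of_epi {M N : FPMod D} (u : M ⟶ N) [Epi u] (W : Dᵒᵖ) :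
    Function.Surjective (u.hom.app W) := by
  have := (isFinitelyPresented D).preservesEpimorphisms_ι_of_isNormalMonoCategory
  have : Epi ((isFinitelyPresented D).ι.map u) := inferInstance
  exact Extri.surjective_of_epi ((isFinitelyPresented D).ι.map u) W

theorem projective_representable (Y : D) : Projective (representable Y) where
  factors {E X} f e _ := by
    have := E.property.1
    obtain ⟨x, hx⟩ := FPMod.surjective_of_epi e (op Y) (f.hom.app (op Y) (𝟙 Y : Y ⟶ Y))
    obtain ⟨u, hu⟩ := (presents_yoneda Y).exists_hom x (by rw [Functor.map_zero]; rfl)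
    refine ⟨ObjectProperty.homMk u, ObjectProperty.hom_ext _ ((presents_yoneda Y).hom_ext ?_)⟩
    exact (comp_app_elem _ _ _).trans ((congrArg (e.hom.app (op Y)) hu).trans hx)

theorem enoughProjectives_FPMod : EnoughProjectives (FPMod D) where
  presentation M := by
    obtain ⟨Y, p, hp⟩ := exists_epi_representable M
    have := projective_representable Y
    exact ⟨{ p := _, projective := this, f := p, epi := hp }⟩

end ProjectiveFP

/-! ### Exact sequences attached to an `𝔰`-triangle -/

namespace Extriangulation

variable {C : Type u} [Category.{v} C] [Preadditive C] [HasZeroObject C] [HasBinaryBiproducts C]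
  {ℰ : Extriangulation C}

theorem push_zero {Z A A' : C} (a : A ⟶ A') : push ℰ.E a (0 : Ext ℰ.E Z A) = 0 := map_zero _

theorem pull_zero {Z Z' A : C} (c : Z' ⟶ Z) : pull ℰ.E c (0 : Ext ℰ.E Z A) = 0 := map_zero _

theorem push_id {Z A : C} (δ : Ext ℰ.E Z A) : push ℰ.E (𝟙 A) δ = δ := map_id_elem _ δ

theorem pull_id {Z A : C} (δ : Ext ℰ.E Z A) : pull ℰ.E (𝟙 Z) δ = δ :=
  map_id_elem (ℰ.E.flip.obj A) δ

theorem push_comp {Z A A' A'' : C} (a : A ⟶ A') (b : A' ⟶ A'') (δ : Ext ℰ.E Z A) :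
    push ℰ.E (a ≫ b) δ = push ℰ.E b (push ℰ.E a δ) := map_comp_elem _ _ _ δ

theorem pull_comp {Z Z' Z'' A : C} (c : Z' ⟶ Z) (d : Z'' ⟶ Z') (δ : Ext ℰ.E Z A) :
    pull ℰ.E (d ≫ c) δ = pull ℰ.E d (pull ℰ.E c δ) :=
  map_comp_elem (ℰ.E.flip.obj A) c.op d.op δ

open ZeroObject in
/-- `0 ⟶ X = X` is an `𝔰`-triangle. -/
theorem tri_zero_id (X : C) : ℰ.IsTri (0 : (0 : C) ⟶ X) (𝟙 X) 0 := by
  have := ℰ.tri_of_iso (b := (⟨biprod.snd, biprod.inr, by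
    apply biprod.hom_ext
    · exact (isZero_zero C).eq_of_tgt _ _
    · simp, by simp⟩ : (0 : C) ⊞ X ≅ X)) (ℰ.tri_zero 0 X)
  simpa using this

open ZeroObject in
/-- `X = X ⟶ 0` is an `𝔰`-triangle. -/
theorem tri_id_zero (X : C) : ℰ.IsTri (𝟙 X) (0 : X ⟶ (0 : C)) 0 := by
  have := ℰ.tri_of_iso (b := (⟨biprod.fst, biprod.inl, by
    apply biprod.hom_ext
    · simp
    · exact (isZero_zero C).eq_of_tgt _ _, by simp⟩ : X ⊞ (0 : C) ≅ X)) (ℰ.tri_zero X 0)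
  simpa using this

variable {A B Z : C} {x : A ⟶ B} {y : B ⟶ Z} {δ : Ext ℰ.E Z A}

namespace IsTri

/-- Comparing with the trivial triangle `A = A ⟶ 0` makes the composite factor through `0`; the
trivial triangles serve in the same way in the next two proofs. -/
theorem comp_eq_zero (h : ℰ.IsTri x y δ) : x ≫ y = 0 := by
  obtain ⟨c, hc, -⟩ := ℰ.et3 (tri_id_zero A) h (𝟙 A) x (by simp)
  rw [← hc, zero_comp]

theorem pull_eq_zero (h : ℰ.IsTri x y δ) : pull ℰ.E y δ = 0 := by
  obtain ⟨a, -, ha⟩ := ℰ.et3_op (tri_zero_id B) h (𝟙 B) y (by simp)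
  rw [← ha, push_zero]

theorem push_eq_zero (h : ℰ.IsTri x y δ) : push ℰ.E x δ = 0 := by
  obtain ⟨c, -, hc⟩ := ℰ.et3 h (tri_id_zero B) x (𝟙 B) (by simp)
  rw [hc, pull_zero]

/-- Exactness of `C(W, B) ⟶ C(W, Z) ⟶ 𝔼(W, A)`: if `c^*δ = 0`, then `(𝟙, c)` is realized by a map
from the split sequence on `A ⊞ W`, and its restriction to `W` is the lift. -/
theorem pull_eq_zero_iff (h : ℰ.IsTri x y δ) {W : C} (c : W ⟶ Z) :
    pull ℰ.E c δ = 0 ↔ ∃ b : W ⟶ B, c = b ≫ y := by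
  constructor
  · intro h0
    obtain ⟨b, -, hb⟩ := ℰ.exists_realization (ℰ.tri_zero A W) h (𝟙 A) c (by rw [push_id, h0])
    exact ⟨biprod.inr ≫ b, by rw [Category.assoc, ← hb, biprod.inr_snd_assoc]⟩
  · rintro ⟨b, rfl⟩
    rw [pull_comp, h.pull_eq_zero, pull_zero]

theorem push_eq_zero_iff (h : ℰ.IsTri x y δ) {W : C} (a : A ⟶ W) :
    push ℰ.E a δ = 0 ↔ ∃ b : B ⟶ W, a = x ≫ b := by
  constructor
  · intro h0
    obtain ⟨b, hb, -⟩ := ℰ.exists_realization h (ℰ.tri_zero W Z) a (𝟙 Z) (by rw [pull_id, h0])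
    exact ⟨b ≫ biprod.fst, by rw [reassoc_of% hb, biprod.inl_fst, Category.comp_id]⟩
  · rintro ⟨b, rfl⟩
    rw [push_comp, h.push_eq_zero, push_zero]

theorem exists_lift (h : ℰ.IsTri x y δ) {W : C} (b : W ⟶ B) (hb : b ≫ y = 0) :
    ∃ a : W ⟶ A, b = a ≫ x := by
  obtain ⟨a, ha, -⟩ := ℰ.et3_op (tri_id_zero W) h b 0 (by simp [hb])
  exact ⟨a, by simpa using ha⟩

theorem exists_desc (h : ℰ.IsTri x y δ) {W : C} (b : B ⟶ W) (hb : x ≫ b = 0) :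
    ∃ c : Z ⟶ W, b = y ≫ c := by
  obtain ⟨c, hc, -⟩ := ℰ.et3 h (tri_zero_id W) 0 b (by simp [hb])
  exact ⟨c, by simpa using hc.symm⟩

end IsTri

/-- If `y` is a deflation then so is `(f, y)`. -/
theorem exists_tri_desc (h : ℰ.IsTri x y δ) {X : C} (f : X ⟶ Z) :
    ∃ (K : C) (k : K ⟶ X ⊞ B) (θ : Ext ℰ.E Z K), ℰ.IsTri k (biprod.desc f y) θ := by
  -- `(f, y)` is the deflation `𝟙 ⊕ y` followed by a shear automorphism of `X ⊞ Z` and the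
  -- projection to `Z`; (ET4)ᵒᵖ composes deflations.
  have h₁ := ℰ.tri_biprod (tri_zero_id X) h
  have h₂ := ℰ.tri_of_iso (b := (⟨biprod.lift biprod.fst (biprod.snd - biprod.fst ≫ f),
    biprod.lift biprod.fst (biprod.desc f (𝟙 Z)), by ext <;> simp, by ext <;> simp⟩ :
      X ⊞ Z ≅ X ⊞ Z)) (ℰ.tri_zero X Z)
  obtain ⟨Q, d, e, h', θ, -, -, -, h₃, -⟩ := ℰ.et4_op h₁ h₂
  refine ⟨Q, h', θ, ?_⟩
  have e : biprod.map (𝟙 X) y ≫ biprod.lift biprod.fst (biprod.desc f (𝟙 Z)) ≫ biprod.snd =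
      biprod.desc f y := by ext <;> simp
  rwa [e] at h₃

/-- If `x` is an inflation then so is `(f, x)`. -/
theorem exists_tri_lift (h : ℰ.IsTri x y δ) {X : C} (f : A ⟶ X) :
    ∃ (K : C) (k : X ⊞ B ⟶ K) (θ : Ext ℰ.E K A), ℰ.IsTri (biprod.lift f x) k θ := by
  -- Dually, `(f, x)` is a sheared split inclusion of `A` followed by `𝟙 ⊕ x`, and (ET4) composes
  -- inflations.
  have h₁ := ℰ.tri_biprod (tri_id_zero X) h
  have h₂ := ℰ.tri_of_iso (b := (⟨biprod.desc (biprod.lift f (𝟙 A)) biprod.inl,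
    biprod.desc biprod.inr (biprod.inl - f ≫ biprod.inr) , by ext <;> simp, by ext <;> simp⟩ :
      A ⊞ X ≅ X ⊞ A)) (ℰ.tri_zero A X)
  obtain ⟨Q, h', d, e, θ, -, -, h₃, -⟩ := ℰ.et4 h₂ h₁
  refine ⟨Q, h', θ, ?_⟩
  have e : (biprod.inl ≫ biprod.desc (biprod.lift f (𝟙 A)) biprod.inl) ≫ biprod.map (𝟙 X) x =
      biprod.lift f x := by ext <;> simp
  rwa [e] at h₃

end Extriangulation

/-! ### The stable categories -/

theorem hasBinaryBiproducts_of_full {A B : Type*} [Category* A] [Category* B] [Preadditive A]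
    [Preadditive B] [HasBinaryBiproducts A] (π : A ⥤ B) [π.Additive]
    (hπ : ∀ X, ∃ Y, π.obj Y = X) : HasBinaryBiproducts B where
  has_binary_biproduct P Q := by
    obtain ⟨P, rfl⟩ := hπ P
    obtain ⟨Q, rfl⟩ := hπ Q
    have := preservesBinaryBiproducts_of_preservesBiproducts π
    infer_instance

open ZeroObject in
theorem hasZeroObject_of_additive {A B : Type*} [Category* A] [Category* B] [Preadditive A]
    [Preadditive B] [HasZeroObject A] (π : A ⥤ B) [π.Additive] : HasZeroObject B :=
  ⟨π.obj 0, π.map_isZero (isZero_zero A)⟩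

namespace Extriangulation

variable {C : Type u} [Category.{v} C] [Preadditive C] [HasZeroObject C] [HasBinaryBiproducts C]
  (ℰ : Extriangulation C)

/-- The projection onto the stable category. -/
abbrev projFunctor : C ⥤ ℰ.ModProj := Quotient.functor _

/-- The projection onto the costable category. -/
abbrev injFunctor : C ⥤ ℰ.ModInj := Quotient.functor _

instance : ℰ.projFunctor.Additive := Quotient.functor_additive _ _

instance : ℰ.injFunctor.Additive := Quotient.functor_additive _ _

instance : HasBinaryBiproducts ℰ.ModProj :=
  hasBinaryBiproducts_of_full ℰ.projFunctor fun X => ⟨X.as, rfl⟩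

instance : HasBinaryBiproducts ℰ.ModInj :=
  hasBinaryBiproducts_of_full ℰ.injFunctor fun X => ⟨X.as, rfl⟩

instance : HasZeroObject ℰ.ModProj := hasZeroObject_of_additive ℰ.projFunctor

instance : HasZeroObject ℰ.ModInj := hasZeroObject_of_additive ℰ.injFunctor

variable {ℰ}

theorem projFunctor_map_eq_zero_iff {X Y : C} (f : X ⟶ Y) :
    ℰ.projFunctor.map f = 0 ↔
      ∃ (P : C) (_ : ℰ.projectives P) (p : X ⟶ P) (q : P ⟶ Y), f = p ≫ q := by
  rw [← ℰ.projFunctor.map_zero, Quotient.functor_map_eq_iff]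
  simp only [idealRel, sub_zero]

theorem injFunctor_map_eq_zero_iff {X Y : C} (f : X ⟶ Y) :
    ℰ.injFunctor.map f = 0 ↔
      ∃ (P : C) (_ : ℰ.injectives P) (p : X ⟶ P) (q : P ⟶ Y), f = p ≫ q := by
  rw [← ℰ.injFunctor.map_zero, Quotient.functor_map_eq_iff]
  simp only [idealRel, sub_zero]

variable {A B Z : C} {x : A ⟶ B} {y : B ⟶ Z} {δ : Ext ℰ.E Z A}

namespace IsTri

theorem factors_of_projFunctor_map_eq_zero (h : ℰ.IsTri x y δ) {W : C} (g : W ⟶ Z)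
    (hg : ℰ.projFunctor.map g = 0) : ∃ l : W ⟶ B, g = l ≫ y := by
  obtain ⟨P, hP, p, q, rfl⟩ := (projFunctor_map_eq_zero_iff g).1 hg
  obtain ⟨b, rfl⟩ := hP h q
  exact ⟨p ≫ b, (Category.assoc _ _ _).symm⟩

theorem factors_of_injFunctor_map_eq_zero (h : ℰ.IsTri x y δ) {W : C} (g : A ⟶ W)
    (hg : ℰ.injFunctor.map g = 0) : ∃ l : B ⟶ W, g = x ≫ l := by
  obtain ⟨P, hP, p, q, rfl⟩ := (injFunctor_map_eq_zero_iff g).1 hg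
  obtain ⟨b, rfl⟩ := hP h p
  exact ⟨b ≫ q, Category.assoc _ _ _⟩

/-- A single deflation from a projective detects the whole ideal on morphisms into `Z`. -/
theorem projFunctor_map_eq_zero_iff (h : ℰ.IsTri x y δ) (hB : ℰ.projectives B) {W : C}
    (g : W ⟶ Z) : ℰ.projFunctor.map g = 0 ↔ ∃ l : W ⟶ B, g = l ≫ y :=
  ⟨h.factors_of_projFunctor_map_eq_zero g, fun ⟨l, hl⟩ =>
    (Extriangulation.projFunctor_map_eq_zero_iff g).2 ⟨B, hB, l, y, hl⟩⟩

theorem injFunctor_map_eq_zero_iff (h : ℰ.IsTri x y δ) (hB : ℰ.injectives B) {W : C}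
    (g : A ⟶ W) : ℰ.injFunctor.map g = 0 ↔ ∃ l : B ⟶ W, g = x ≫ l :=
  ⟨h.factors_of_injFunctor_map_eq_zero g, fun ⟨l, hl⟩ =>
    (Extriangulation.injFunctor_map_eq_zero_iff g).2 ⟨B, hB, x, l, hl⟩⟩

end IsTri

/-- Adding a projective `P` to the source turns `f` into the deflation `(f, y)`; the first component
of its inflation is a weak kernel of `f` once `P` is killed. -/
theorem hasWeakKernels_modProj (hP : ℰ.HasEnoughProjectives) : HasWeakKernels ℰ.ModProj := by
  rintro ⟨X⟩ ⟨Y⟩ f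
  obtain ⟨f, rfl⟩ := ℰ.projFunctor.map_surjective (X := X) (Y := Y) f
  obtain ⟨A, P, x, y, δ, h, hPP⟩ := hP Y
  obtain ⟨K, k, θ, hk⟩ := exists_tri_desc h f
  refine ⟨⟨K⟩, ℰ.projFunctor.map (k ≫ biprod.fst), ?_, ?_⟩
  · refine (ℰ.projFunctor.map_comp _ _).symm.trans ?_
    rw [h.projFunctor_map_eq_zero_iff hPP]
    refine ⟨-(k ≫ biprod.snd), ?_⟩
    have := hk.comp_eq_zero
    rw [biprod.desc_eq, Preadditive.comp_add] at this
    simpa [add_eq_zero_iff_eq_neg] using this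
  · rintro ⟨W⟩ g hg
    obtain ⟨g, rfl⟩ := ℰ.projFunctor.map_surjective (X := W) (Y := X) g
    obtain ⟨l, hl⟩ := h.factors_of_projFunctor_map_eq_zero (g ≫ f)
      ((ℰ.projFunctor.map_comp _ _).trans hg)
    obtain ⟨m, hm⟩ := hk.exists_lift (biprod.lift g (-l)) (by simp [hl])
    refine ⟨ℰ.projFunctor.map m, ?_⟩
    refine Eq.trans ?_ (ℰ.projFunctor.map_comp _ _)
    have := hm =≫ biprod.fst
    rw [biprod.lift_fst, Category.assoc] at this
    rw [← this]

theorem hasWeakKernels_modInj (hI : ℰ.HasEnoughInjectives) : HasWeakKernels ℰ.ModInjᵒᵖ := by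
  rintro ⟨⟨X⟩⟩ ⟨⟨Y⟩⟩ ⟨f⟩
  obtain ⟨f, rfl⟩ := ℰ.injFunctor.map_surjective (X := Y) (Y := X) f
  obtain ⟨I, Z, x, y, δ, h, hII⟩ := hI Y
  obtain ⟨K, k, θ, hk⟩ := exists_tri_lift h f
  refine ⟨op ⟨K⟩, (ℰ.injFunctor.map (biprod.inl ≫ k)).op, Quiver.Hom.unop_inj ?_, ?_⟩
  · refine (ℰ.injFunctor.map_comp _ _).symm.trans ?_
    refine (h.injFunctor_map_eq_zero_iff hII _).2 ⟨-(biprod.inr ≫ k), ?_⟩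
    have := hk.comp_eq_zero
    rw [biprod.lift_eq, Preadditive.add_comp] at this
    simpa [add_eq_zero_iff_eq_neg] using this
  · rintro ⟨⟨W⟩⟩ ⟨g⟩ hg
    obtain ⟨g, rfl⟩ := ℰ.injFunctor.map_surjective (X := X) (Y := W) g
    obtain ⟨l, hl⟩ := h.factors_of_injFunctor_map_eq_zero (f ≫ g)
      ((ℰ.injFunctor.map_comp _ _).trans (congrArg Quiver.Hom.unop hg))
    obtain ⟨m, hm⟩ := hk.exists_desc (biprod.desc g (-l)) (by simp [hl])
    refine ⟨(ℰ.injFunctor.map m).op, Quiver.Hom.unop_inj ?_⟩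
    refine Eq.trans ?_ (ℰ.injFunctor.map_comp _ _)
    have := biprod.inl ≫= hm
    rw [biprod.inl_desc] at this
    rw [Category.assoc, ← this]
    rfl

end Extriangulation

/-! ### Equivalences induced by full functors -/

theorem whiskeringLeft_faithful {A B : Type*} [Category* A] [Category* B] (π : A ⥤ B) [π.EssSurj]
    (E : Type*) [Category* E] : ((Functor.whiskeringLeft A B E).obj π).Faithful where
  map_injective {F G} u w h := by
    ext X
    have := NatTrans.congr_app h (π.objPreimage X)
    dsimp at this
    rw [← cancel_epi (F.map (π.objObjPreimageIso X).hom), u.naturality, w.naturality, this]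

/-- Fullness of `π` makes a transformation natural for all morphisms between objects `π.obj X`; it
then extends along isomorphisms from chosen preimages. -/
theorem whiskeringLeft_full {A B : Type*} [Category* A] [Category* B] (π : A ⥤ B) [π.EssSurj]
    [π.Full] (E : Type*) [Category* E] : ((Functor.whiskeringLeft A B E).obj π).Full where
  map_surjective {F G} u := by
    have nat : ∀ {X Y : A} (f : π.obj X ⟶ π.obj Y), F.map f ≫ u.app Y = u.app X ≫ G.map f :=
      fun {X Y} f => by
        obtain ⟨f, rfl⟩ := π.map_surjective f
        exact u.naturality f
    refine ⟨{ app := fun X => F.map (π.objObjPreimageIso X).inv ≫ u.app (π.objPreimage X) ≫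
                G.map (π.objObjPreimageIso X).hom
              naturality := fun X Y f => ?_ }, ?_⟩
    · rw [← cancel_mono (G.map (π.objObjPreimageIso Y).inv),
        ← cancel_epi (F.map (π.objObjPreimageIso X).hom)]
      have := nat ((π.objObjPreimageIso X).hom ≫ f ≫ (π.objObjPreimageIso Y).inv)
      simpa [← Functor.map_comp_assoc, ← Functor.map_comp] using this
    · ext X
      have := nat (π.objObjPreimageIso (π.obj X)).inv
      dsimp
      rw [reassoc_of% this, ← G.map_comp, Iso.inv_hom_id, G.map_id]
      exact Category.comp_id _

/-- The formal part shared by both defects: `d` lifts through the fully faithful `ρ`, the lift is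
full and essentially surjective, and dividing by `r` makes it faithful. -/
theorem exists_quotient_equivalence {T A B : Type*} [Category* T] [Category* A] [Category* B]
    (r : HomRel T) [Congruence r] (d : T ⥤ B) [d.Full] (ρ : A ⥤ B) [ρ.Full] [ρ.Faithful]
    (hd : ∀ {X Y : T} (φ ψ : X ⟶ Y), d.map φ = d.map ψ ↔ r φ ψ)
    (h₁ : ∀ X : T, ρ.essImage (d.obj X)) (h₂ : ∀ M : A, d.essImage (ρ.obj M)) :
    ∃ F : Quotient r ≌ A, Nonempty (Quotient.functor r ⋙ F.functor ⋙ ρ ≅ d) := by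
  let F₀ : T ⥤ A := Functor.essImage.liftFunctor d ρ h₁
  let e : F₀ ⋙ ρ ≅ d := Functor.essImage.liftFunctorCompIso d ρ h₁
  have hmap : ∀ {X Y : T} (φ ψ : X ⟶ Y), F₀.map φ = F₀.map ψ ↔ r φ ψ := by
    intro X Y φ ψ
    rw [← hd, ← ρ.map_injective.eq_iff]
    have h := fun χ : X ⟶ Y => e.hom.naturality χ
    constructor
    · intro h'
      rw [← cancel_epi (e.hom.app X), ← h, ← h, Functor.comp_map, Functor.comp_map, h']
    · intro h'
      rw [← cancel_mono (e.hom.app Y)]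
      exact (h φ).trans ((congrArg (e.hom.app X ≫ ·) h').trans (h ψ).symm)
  have : (F₀ ⋙ ρ).Full := Functor.Full.of_iso e.symm
  have : F₀.Full := Functor.Full.of_comp_faithful F₀ ρ
  let F : Quotient r ⥤ A := CategoryTheory.Quotient.lift r F₀ fun X Y φ ψ h => (hmap φ ψ).2 h
  have : F.Full := ⟨by
    rintro ⟨X⟩ ⟨Y⟩ f
    obtain ⟨f, rfl⟩ := F₀.map_surjective f
    exact ⟨(Quotient.functor r).map f, rfl⟩⟩
  have : F.Faithful := ⟨by
    rintro ⟨X⟩ ⟨Y⟩ ⟨f⟩ ⟨g⟩ h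
    exact CategoryTheory.Quotient.sound r ((hmap f g).1 h)⟩
  have : F.EssSurj := ⟨fun M => by
    obtain ⟨X, ⟨i⟩⟩ := h₂ M
    exact ⟨⟨X⟩, ⟨ρ.preimageIso (e.app X ≪≫ i)⟩⟩⟩
  have : F.IsEquivalence := {}
  exact ⟨F.asEquivalence, ⟨e⟩⟩

namespace Extriangulation

variable {C : Type u} [Category.{v} C] [Preadditive C] [HasZeroObject C] [HasBinaryBiproducts C]
  (ℰ : Extriangulation C)

instance : ℰ.resProj.Full := by
  have := whiskeringLeft_full (Quotient.functor (idealRel ℰ.projectives)).op AddCommGrpCat.{v}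
  infer_instance

instance : ℰ.resProj.Faithful := by
  have := whiskeringLeft_faithful (Quotient.functor (idealRel ℰ.projectives)).op AddCommGrpCat.{v}
  infer_instance

instance : ℰ.covInj.Full := by
  have := whiskeringLeft_full (opOp ℰ.ModInj) AddCommGrpCat.{v}
  infer_instance

instance : ℰ.covInj.Faithful := by
  have := whiskeringLeft_faithful (opOp ℰ.ModInj) AddCommGrpCat.{v}
  infer_instance

instance : ℰ.resInj.Full := by
  have := whiskeringLeft_full (Quotient.functor (idealRel ℰ.injectives)) AddCommGrpCat.{v}
  infer_instance

instance : ℰ.resInj.Faithful := by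
  have := whiskeringLeft_faithful (Quotient.functor (idealRel ℰ.injectives)) AddCommGrpCat.{v}
  infer_instance

/-! ### The contravariant defect -/

variable {ℰ}

instance (X : ℰ.STri) : (ℰ.contravariantDefect.obj X).Additive :=
  show (cokernel (preadditiveYoneda.map X.f₂)).Additive from additive_of_epi (cokernel.π _)

/-- The canonical generator of the contravariant defect. -/
noncomputable def STri.gen (X : ℰ.STri) : (ℰ.contravariantDefect.obj X).obj (op X.X₃) :=
  (cokernel.π (preadditiveYoneda.map X.f₂)).app (op X.X₃)
    (show (preadditiveYoneda.obj X.X₃).obj (op X.X₃) from 𝟙 X.X₃)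

theorem STri.presents_gen (X : ℰ.STri) :
    Presents (ℰ.contravariantDefect.obj X) X.f₂.op X.gen :=
  presents_cokernel_yoneda X.f₂

theorem contravariantDefect_map_gen {X Y : ℰ.STri} (φ : X ⟶ Y) :
    (ℰ.contravariantDefect.map φ).app _ X.gen =
      (ℰ.contravariantDefect.obj Y).map (STriHom.φ₃ φ).op Y.gen := by
  refine (comp_app_elem _ _ _).symm.trans ?_
  refine (congrArg (fun u : preadditiveYoneda.obj X.X₃ ⟶ ℰ.contravariantDefect.obj Y =>
    u.app (op X.X₃) (𝟙 X.X₃ : X.X₃ ⟶ X.X₃)) (cokernel.π_desc _ _ _)).trans ?_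
  refine (comp_app_elem _ _ _).trans ?_
  refine Eq.trans ?_ (naturality_elem (cokernel.π (preadditiveYoneda.map Y.f₂))
    (STriHom.φ₃ φ).op _)
  refine congrArg _ ?_
  exact (show 𝟙 X.X₃ ≫ STriHom.φ₃ φ = STriHom.φ₃ φ ≫ 𝟙 Y.X₃ by simp)

theorem contravariantDefect_map_eq_iff {X Y : ℰ.STri} (φ ψ : X ⟶ Y) :
    ℰ.contravariantDefect.map φ = ℰ.contravariantDefect.map ψ ↔ ℰ.relR₂ φ ψ := by
  have : ℰ.contravariantDefect.map φ = ℰ.contravariantDefect.map ψ ↔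
      (ℰ.contravariantDefect.obj Y).map ((STriHom.φ₃ φ).op - (STriHom.φ₃ ψ).op) Y.gen = 0 := by
    rw [map_sub_elem, sub_eq_zero, ← contravariantDefect_map_gen, ← contravariantDefect_map_gen]
    exact ⟨fun h => by rw [h], X.presents_gen.hom_ext⟩
  rw [this, Y.presents_gen.map_eq_zero_iff]
  exact ⟨fun ⟨h, e⟩ => ⟨h.unop, congrArg Quiver.Hom.unop e⟩,
    fun ⟨h, e⟩ => ⟨h.op, Quiver.Hom.unop_inj e⟩⟩

instance : ℰ.contravariantDefect.Full where
  map_surjective {X Y} u := by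
    -- The image of the generator gives `φ₃`, the vanishing of the relation gives `φ₂`, and (ET3)ᵒᵖ
    -- completes them with `φ₁`.
    obtain ⟨c, hc⟩ := Y.presents_gen.generates (u.app _ X.gen)
    obtain ⟨b, hb⟩ := (Y.presents_gen.map_eq_zero_iff (c ≫ X.f₂.op)).1 (by
      rw [map_comp_elem, hc, ← naturality_elem, X.presents_gen.map_self, map_zero])
    have hb' : X.f₂ ≫ c.unop = b.unop ≫ Y.f₂ := congrArg Quiver.Hom.unop hb
    obtain ⟨a, ha, ha'⟩ := ℰ.et3_op X.isTri Y.isTri b.unop c.unop hb'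
    let φ : ℰ.STriHom X Y := ⟨a, b.unop, c.unop, ha, hb', ha'⟩
    refine ⟨φ, X.presents_gen.hom_ext ?_⟩
    rw [← hc]
    exact contravariantDefect_map_gen (X := X) (Y := Y) φ

/-- Morphisms into `X₃` that vanish in `C/[𝒫]` already factor through the deflation `f₂`, so passing
to the stable category adds no relations. -/
theorem essImage_resProj (X : ℰ.STri) : ℰ.resProj.essImage (ℰ.contravariantDefect.obj X) := by
  let N : FPMod ℰ.ModProj := ⟨_, isFinitelyPresented_cokernel (ℰ.projFunctor.map X.f₂)⟩
  have hN := presents_cokernel_yoneda (ℰ.projFunctor.map X.f₂)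
  have := hN.comp (π := ℰ.projFunctor.op) (k := X.f₂.op) fun g hg => by
    obtain ⟨l, hl⟩ := X.isTri.factors_of_projFunctor_map_eq_zero g.unop
      (congrArg Quiver.Hom.unop hg)
    exact ⟨l.op, Quiver.Hom.unop_inj hl⟩
  have hNa : (N.obj).Additive := N.property.1
  have : (ℰ.resProj.obj N).Additive := inferInstanceAs (ℰ.projFunctor.op ⋙ N.obj).Additive
  obtain ⟨e, -⟩ := Presents.nonempty_iso (F := ℰ.resProj.obj N) ‹_› X.presents_gen
  exact ⟨N, ⟨e⟩⟩

theorem essImage_contravariantDefect (hP : ℰ.HasEnoughProjectives) (M : FPMod ℰ.ModProj) :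
    ℰ.contravariantDefect.essImage (ℰ.resProj.obj M) := by
  obtain ⟨hM, ⟨X⟩, ⟨Y⟩, f, ξ, h⟩ := (isFinitelyPresented_iff _).1 M.property
  obtain ⟨f, rfl⟩ := ℰ.projFunctor.map_surjective (X := X) (Y := Y) f
  obtain ⟨A, P, x, y, δ, hy, hPP⟩ := hP Y
  obtain ⟨K, k, θ, hk⟩ := exists_tri_desc hy f
  let T : ℰ.STri := ⟨_, _, θ, hk⟩
  have hres : Presents (ℰ.resProj.obj M) (biprod.desc f y).op
      (show (ℰ.resProj.obj M).obj (op Y) from ξ) := by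
    refine ⟨fun {W} η => ?_, fun {W} g => ?_⟩
    · obtain ⟨g, hg⟩ := h.generates (W := ℰ.projFunctor.op.obj W) η
      obtain ⟨g, rfl⟩ := ℰ.projFunctor.op.map_surjective (X := op Y) (Y := W) g
      exact ⟨g, hg⟩
    · refine (h.map_eq_zero_iff (ℰ.projFunctor.op.map g)).trans ⟨?_, ?_⟩
      · rintro ⟨l, hl⟩
        obtain ⟨l, rfl⟩ := ℰ.projFunctor.op.map_surjective (X := op X) (Y := W) l
        -- The error of lifting the factorization to `C` passes through a projective, hence through
        -- `y`: it is the second component of a factorization through `(f, y)`.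
        obtain ⟨m, hm⟩ := hy.factors_of_projFunctor_map_eq_zero (g.unop - l.unop ≫ f) (by
          rw [Functor.map_sub, sub_eq_zero, Functor.map_comp]
          exact congrArg Quiver.Hom.unop hl)
        exact ⟨(biprod.lift l.unop m).op, Quiver.Hom.unop_inj (by simp [← hm])⟩
      · rintro ⟨l, rfl⟩
        have e : ((biprod.desc f y).op ≫ l).unop =
            (l.unop ≫ biprod.fst) ≫ f + (l.unop ≫ biprod.snd) ≫ y := by
          simp [biprod.desc_eq]
        refine ⟨(ℰ.projFunctor.map (l.unop ≫ biprod.fst)).op, Quiver.Hom.unop_inj ?_⟩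
        change ℰ.projFunctor.map ((biprod.desc f y).op ≫ l).unop =
          ℰ.projFunctor.map (l.unop ≫ biprod.fst) ≫ ℰ.projFunctor.map f
        rw [e, Functor.map_add, Functor.map_comp, add_eq_left,
          hy.projFunctor_map_eq_zero_iff hPP]
        exact ⟨_, rfl⟩
  have : (ℰ.resProj.obj M).Additive := inferInstanceAs (ℰ.projFunctor.op ⋙ M.obj).Additive
  obtain ⟨e, -⟩ := T.presents_gen.nonempty_iso hres
  exact ⟨T, ⟨e⟩⟩

end Extriangulation

/-! ### The covariant defect -/

namespace Extriangulation

variable {C : Type u} [Category.{v} C] [Preadditive C] [HasZeroObject C] [HasBinaryBiproducts C]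
  {ℰ : Extriangulation C}

instance (X : ℰ.STri) : (ℰ.covariantDefect.obj X).unop.Additive :=
  show (cokernel (preadditiveCoyoneda.map X.f₁.op)).Additive from additive_of_epi (cokernel.π _)

/-- The canonical generator of the covariant defect. -/
noncomputable def STri.cogen (X : ℰ.STri) : (ℰ.covariantDefect.obj X).unop.obj X.X₁ :=
  (cokernel.π (preadditiveCoyoneda.map X.f₁.op)).app X.X₁
    (show (preadditiveCoyoneda.obj (op X.X₁)).obj X.X₁ from 𝟙 X.X₁)

theorem STri.presents_cogen (X : ℰ.STri) :
    Presents (ℰ.covariantDefect.obj X).unop X.f₁ X.cogen :=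
  presents_cokernel_coyoneda X.f₁

theorem covariantDefect_map_cogen {X Y : ℰ.STri} (φ : X ⟶ Y) :
    (ℰ.covariantDefect.map φ).unop.app _ Y.cogen =
      (ℰ.covariantDefect.obj X).unop.map (STriHom.φ₁ φ) X.cogen := by
  refine (comp_app_elem _ _ _).symm.trans ?_
  refine (congrArg (fun u : preadditiveCoyoneda.obj (op Y.X₁) ⟶ (ℰ.covariantDefect.obj X).unop =>
    u.app Y.X₁ (𝟙 Y.X₁ : Y.X₁ ⟶ Y.X₁)) (cokernel.π_desc _ _ _)).trans ?_
  refine (comp_app_elem _ _ _).trans ?_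
  refine Eq.trans ?_ (naturality_elem (cokernel.π (preadditiveCoyoneda.map X.f₁.op))
    (STriHom.φ₁ φ) _)
  refine congrArg _ ?_
  exact (show STriHom.φ₁ φ ≫ 𝟙 Y.X₁ = 𝟙 X.X₁ ≫ STriHom.φ₁ φ by simp)

/-- `ℛ₂` is self-dual: both conditions say that the extension obtained by pushing `X.δ` along the
difference of the `φ₁`, equivalently pulling `Y.δ` back along that of the `φ₃`, is zero. -/
theorem relR₂_iff {X Y : ℰ.STri} (φ ψ : X ⟶ Y) :
    ℰ.relR₂ φ ψ ↔ ∃ p : X.X₂ ⟶ Y.X₁, STriHom.φ₁ φ - STriHom.φ₁ ψ = X.f₁ ≫ p := by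
  have := ℰ.additive_left (op X.X₃)
  have := ℰ.additive_right Y.X₁
  have e : push ℰ.E (STriHom.φ₁ φ - STriHom.φ₁ ψ) X.δ =
      pull ℰ.E (STriHom.φ₃ φ - STriHom.φ₃ ψ) Y.δ := by
    refine (map_sub_elem (ℰ.E.obj (op X.X₃)) _ _ _).trans ?_
    refine Eq.trans ?_ (map_sub_elem (ℰ.E.flip.obj Y.X₁) (STriHom.φ₃ φ).op (STriHom.φ₃ ψ).op
      (show (ℰ.E.flip.obj Y.X₁).obj (op Y.X₃) from Y.δ)).symm
    exact congrArg₂ (· - ·) (STriHom.comm₃ φ) (STriHom.comm₃ ψ)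
  rw [← X.isTri.push_eq_zero_iff, e, Y.isTri.pull_eq_zero_iff]
  rfl

theorem covariantDefect_map_eq_iff {X Y : ℰ.STri} (φ ψ : X ⟶ Y) :
    ℰ.covariantDefect.map φ = ℰ.covariantDefect.map ψ ↔ ℰ.relR₂ φ ψ := by
  have : ℰ.covariantDefect.map φ = ℰ.covariantDefect.map ψ ↔
      (ℰ.covariantDefect.obj X).unop.map (STriHom.φ₁ φ - STriHom.φ₁ ψ) X.cogen = 0 := by
    rw [map_sub_elem, sub_eq_zero, ← covariantDefect_map_cogen, ← covariantDefect_map_cogen]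
    exact ⟨fun h => by rw [h], fun h => Quiver.Hom.unop_inj (Y.presents_cogen.hom_ext h)⟩
  rw [this, X.presents_cogen.map_eq_zero_iff, relR₂_iff]

instance : ℰ.covariantDefect.Full where
  map_surjective {X Y} u := by
    obtain ⟨a, ha⟩ := X.presents_cogen.generates (u.unop.app _ Y.cogen)
    obtain ⟨b, hb⟩ := (X.presents_cogen.map_eq_zero_iff (a ≫ Y.f₁)).1 (by
      rw [map_comp_elem, ha, ← naturality_elem, Y.presents_cogen.map_self, map_zero])
    obtain ⟨c, hc, hc'⟩ := ℰ.et3 X.isTri Y.isTri a b hb.symm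
    let φ : ℰ.STriHom X Y := ⟨a, b, c, hb.symm, hc, hc'⟩
    refine ⟨φ, Quiver.Hom.unop_inj (Y.presents_cogen.hom_ext ?_)⟩
    rw [← ha]
    exact covariantDefect_map_cogen (X := X) (Y := Y) φ

/-- The projection `C ⥤ C/[ℐ]`, with values in the double opposite category. -/
abbrev injFunctorOpOp (ℰ : Extriangulation C) : C ⥤ (ℰ.ModInj)ᵒᵖᵒᵖ :=
  ℰ.injFunctor ⋙ opOp ℰ.ModInj

instance : (opOp ℰ.ModInj).Additive where

instance (N : FPMod (ℰ.ModInj)ᵒᵖ) : (ℰ.covInj.obj N).Additive :=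
  have : N.obj.Additive := N.property.1
  inferInstanceAs (opOp ℰ.ModInj ⋙ N.obj).Additive

instance (N : FPMod (ℰ.ModInj)ᵒᵖ) : (ℰ.resInj.obj N).Additive :=
  inferInstanceAs (ℰ.injFunctor ⋙ ℰ.covInj.obj N).Additive

theorem essImage_resInj (X : ℰ.STri) :
    ℰ.resInj.op.essImage (ℰ.covariantDefect.obj X) := by
  let N : FPMod (ℰ.ModInj)ᵒᵖ :=
    ⟨_, isFinitelyPresented_cokernel (ℰ.injFunctor.map X.f₁).op⟩
  have hN := presents_cokernel_yoneda (ℰ.injFunctor.map X.f₁).op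
  have := hN.comp (π := ℰ.injFunctorOpOp) (k := X.f₁) fun g hg =>
    X.isTri.factors_of_injFunctor_map_eq_zero g
      (congrArg (fun f => Quiver.Hom.unop (Quiver.Hom.unop f)) hg)
  obtain ⟨e, -⟩ := X.presents_cogen.nonempty_iso (G := ℰ.resInj.obj N) this
  exact ⟨op N, ⟨e.op⟩⟩

theorem essImage_covariantDefect (hI : ℰ.HasEnoughInjectives) (M : (FPMod (ℰ.ModInj)ᵒᵖ)ᵒᵖ) :
    ℰ.covariantDefect.essImage (ℰ.resInj.op.obj M) := by
  obtain ⟨M⟩ := M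
  obtain ⟨hM, ⟨⟨X⟩⟩, ⟨⟨Y⟩⟩, ⟨f⟩, ξ, h⟩ := (isFinitelyPresented_iff _).1 M.property
  obtain ⟨f, rfl⟩ := ℰ.injFunctor.map_surjective (X := Y) (Y := X) f
  obtain ⟨I, Z, x, y, δ, hx, hII⟩ := hI Y
  obtain ⟨K, k, θ, hk⟩ := exists_tri_lift hx f
  let T : ℰ.STri := ⟨_, _, θ, hk⟩
  have hres : Presents (ℰ.resInj.obj M) (biprod.lift f x)
      (show (ℰ.resInj.obj M).obj Y from ξ) := by
    refine ⟨fun {W} η => ?_, fun {W} g => ?_⟩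
    · obtain ⟨g, hg⟩ := h.generates (W := ℰ.injFunctorOpOp.obj W) η
      obtain ⟨g, rfl⟩ := ℰ.injFunctorOpOp.map_surjective (X := Y) (Y := W) g
      exact ⟨g, hg⟩
    · refine (h.map_eq_zero_iff (ℰ.injFunctorOpOp.map g)).trans ⟨?_, ?_⟩
      · rintro ⟨l, hl⟩
        obtain ⟨l, rfl⟩ := ℰ.injFunctorOpOp.map_surjective (X := X) (Y := W) l
        obtain ⟨m, hm⟩ := hx.factors_of_injFunctor_map_eq_zero (g - f ≫ l) (by
          rw [Functor.map_sub, sub_eq_zero, Functor.map_comp]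
          exact congrArg (fun f => Quiver.Hom.unop (Quiver.Hom.unop f)) hl)
        exact ⟨biprod.desc l m, by simp [← hm]⟩
      · rintro ⟨l, rfl⟩
        have e : biprod.lift f x ≫ l = f ≫ biprod.inl ≫ l + x ≫ biprod.inr ≫ l := by
          simp [biprod.lift_eq]
        refine ⟨ℰ.injFunctorOpOp.map (biprod.inl ≫ l),
          Quiver.Hom.unop_inj (Quiver.Hom.unop_inj ?_)⟩
        change ℰ.injFunctor.map (biprod.lift f x ≫ l) =
          ℰ.injFunctor.map f ≫ ℰ.injFunctor.map (biprod.inl ≫ l)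
        rw [e, Functor.map_add, Functor.map_comp _ f, add_eq_left,
          hx.injFunctor_map_eq_zero_iff hII]
        exact ⟨_, rfl⟩
  obtain ⟨e, -⟩ := T.presents_cogen.nonempty_iso hres
  exact ⟨T, ⟨e.symm.op⟩⟩

end Extriangulation

/-! ### Injective modules -/

/-- Under a duality, the objects corresponding to representable modules are injective, and they
control all injective objects. -/
theorem injectives_of_duality {D : Type u} [Category.{v} D] [Preadditive D] [HasZeroObject D]
    [HasBinaryBiproducts D] {A : Type*} [Category* A] (Φ : A ≌ (FPMod D)ᵒᵖ) (E : D → A)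
    (e : ∀ Y, Nonempty (Φ.functor.obj (E Y) ≅ op (representable Y))) :
    EnoughInjectives A ∧ (∀ Y, Injective (E Y)) ∧
      (∀ M, Injective M → ∃ Y, Nonempty (Retract M (E Y))) ∧
      (IsIdempotentComplete D → ∀ M, Injective M → ∃ Y, Nonempty (M ≅ E Y)) := by
  -- The duality exchanges injectives of `A` with projectives of `FPMod D`, for which the statements
  -- are known.
  have hproj : ∀ M, Injective M → Projective (Φ.functor.obj M).unop := fun M hM => by
    have := (Φ.map_injective_iff M).2 hM
    infer_instance
  refine ⟨?_, fun Y => ?_, fun M hM => ?_, fun hD M hM => ?_⟩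
  · have : EnoughProjectives (FPMod D) := enoughProjectives_FPMod
    exact Φ.enoughInjectives_iff.2 inferInstance
  · have := projective_representable Y
    obtain ⟨i⟩ := e Y
    exact (Φ.map_injective_iff _).1 (Injective.of_iso i.symm inferInstance)
  · have := hproj M hM
    obtain ⟨Y, ⟨r⟩⟩ := exists_retract_representable (Φ.functor.obj M).unop
    obtain ⟨i⟩ := e Y
    have r' : Retract (Φ.functor.obj M) (Φ.functor.obj (E Y)) := r.op.trans (.ofIso i.symm)
    exact ⟨Y, ⟨⟨Φ.functor.preimage r'.i, Φ.functor.preimage r'.r,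
      Φ.functor.map_injective (by simp)⟩⟩⟩
  · have := hproj M hM
    obtain ⟨Y, ⟨r⟩⟩ := exists_iso_representable (Φ.functor.obj M).unop
    obtain ⟨i⟩ := e Y
    have r' : Φ.functor.obj M ≅ Φ.functor.obj (E Y) := r.symm.op ≪≫ i.symm
    exact ⟨Y, ⟨Φ.functor.preimageIso r'⟩⟩

namespace Extriangulation

variable {C : Type u} [Category.{v} C] [Preadditive C] [HasZeroObject C] [HasBinaryBiproducts C]
  {ℰ : Extriangulation C}

/-- `T.δ` generates `𝔼(-, X₁)`: as `X₂` is injective, `f₁` extends along the inflation of any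
extension of `X₁`, and (ET3) exhibits that extension as a pullback of `T.δ`. The relations are those
of `f₂` by exactness. -/
theorem nonempty_contravariantDefect_iso_ext (T : ℰ.STri) (hT : ℰ.injectives T.X₂) :
    Nonempty (ℰ.contravariantDefect.obj T ≅ ℰ.E.flip.obj T.X₁) := by
  have := ℰ.additive_right T.X₁
  have h : Presents (ℰ.E.flip.obj T.X₁) T.f₂.op
      (show (ℰ.E.flip.obj T.X₁).obj (op T.X₃) from T.δ) := by
    refine ⟨fun {W} η => ?_, fun {W} g => ?_⟩
    · obtain ⟨M, x, y, hM⟩ := ℰ.exists_tri (Z := W.unop) (A := T.X₁) η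
      obtain ⟨b, hb⟩ := hT hM T.f₁
      obtain ⟨c, -, hc⟩ := ℰ.et3 hM T.isTri (𝟙 _) b (by simp [hb])
      exact ⟨c.op, (push_id (Z := W.unop) (A := T.X₁) η ▸ hc).symm⟩
    · exact (T.isTri.pull_eq_zero_iff g.unop).trans
        ⟨fun ⟨b, hb⟩ => ⟨b.op, Quiver.Hom.unop_inj hb⟩,
          fun ⟨b, hb⟩ => ⟨b.unop, congrArg Quiver.Hom.unop hb⟩⟩
  obtain ⟨e, -⟩ := T.presents_gen.nonempty_iso h
  exact ⟨e⟩

theorem nonempty_covariantDefect_iso_ext (T : ℰ.STri) (hT : ℰ.projectives T.X₂) :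
    Nonempty ((ℰ.covariantDefect.obj T).unop ≅ ℰ.E.obj (op T.X₃)) := by
  have := ℰ.additive_left (op T.X₃)
  have h : Presents (ℰ.E.obj (op T.X₃)) T.f₁ T.δ := by
    refine ⟨fun {W} η => ?_, fun {W} g => T.isTri.push_eq_zero_iff g⟩
    obtain ⟨M, x, y, hM⟩ := ℰ.exists_tri (Z := T.X₃) (A := W) η
    obtain ⟨b, hb⟩ := hT hM T.f₂
    obtain ⟨a, -, ha⟩ := ℰ.et3_op T.isTri hM b (𝟙 _) (by simp [hb])
    exact ⟨a, ha.trans (pull_id (Z := T.X₃) (A := W) η)⟩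
  obtain ⟨e, -⟩ := T.presents_cogen.nonempty_iso h
  exact ⟨e⟩

theorem nonempty_contravariantDefect_iso_representable (T : ℰ.STri) (hT : ℰ.projectives T.X₂) :
    Nonempty (ℰ.contravariantDefect.obj T ≅
      ℰ.resProj.obj (representable (ℰ.projFunctor.obj T.X₃))) := by
  have h : Presents (ℰ.resProj.obj (representable (ℰ.projFunctor.obj T.X₃))) T.f₂.op
      (show (ℰ.resProj.obj (representable (ℰ.projFunctor.obj T.X₃))).obj (op T.X₃) from
        𝟙 (ℰ.projFunctor.obj T.X₃)) := by
    refine ⟨fun {W} η => ?_, fun {W} g => ?_⟩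
    · obtain ⟨g, hg⟩ := ℰ.projFunctor.map_surjective (X := W.unop) (Y := T.X₃) η
      exact ⟨g.op, (Category.comp_id (ℰ.projFunctor.map g)).trans hg⟩
    · have h0 : ℰ.projFunctor.map g.unop ≫ 𝟙 (ℰ.projFunctor.obj T.X₃) = 0 ↔
          ∃ l : W.unop ⟶ T.X₂, g.unop = l ≫ T.f₂ := by
        rw [Category.comp_id, T.isTri.projFunctor_map_eq_zero_iff hT]
      exact h0.trans ⟨fun ⟨b, hb⟩ => ⟨b.op, Quiver.Hom.unop_inj hb⟩,
          fun ⟨b, hb⟩ => ⟨b.unop, congrArg Quiver.Hom.unop hb⟩⟩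
  have : (ℰ.resProj.obj (representable (ℰ.projFunctor.obj T.X₃))).Additive :=
    inferInstanceAs (ℰ.projFunctor.op ⋙ preadditiveYoneda.obj _).Additive
  obtain ⟨e, -⟩ := T.presents_gen.nonempty_iso h
  exact ⟨e⟩

theorem nonempty_covariantDefect_iso_representable (T : ℰ.STri) (hT : ℰ.injectives T.X₂) :
    Nonempty ((ℰ.covariantDefect.obj T).unop ≅
      ℰ.resInj.obj (representable (op (ℰ.injFunctor.obj T.X₁)))) := by
  have h : Presents (ℰ.resInj.obj (representable (op (ℰ.injFunctor.obj T.X₁)))) T.f₁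
      (show (ℰ.resInj.obj (representable (op (ℰ.injFunctor.obj T.X₁)))).obj T.X₁ from
        𝟙 (op (ℰ.injFunctor.obj T.X₁))) := by
    refine ⟨fun {W} η => ?_, fun {W} g => ?_⟩
    · obtain ⟨g, hg⟩ := ℰ.injFunctor.map_surjective (X := T.X₁) (Y := W) (Quiver.Hom.unop η)
      exact ⟨g, (Category.comp_id (ℰ.injFunctor.map g).op).trans (congrArg Quiver.Hom.op hg)⟩
    · have h0 : (ℰ.injFunctor.map g).op ≫ 𝟙 (op (ℰ.injFunctor.obj T.X₁)) = 0 ↔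
          ∃ l : T.X₂ ⟶ W, g = T.f₁ ≫ l := by
        rw [Category.comp_id, ← T.isTri.injFunctor_map_eq_zero_iff hT]
        exact ⟨fun h => Quiver.Hom.op_inj h, fun h => Quiver.Hom.unop_inj h⟩
      exact h0
  obtain ⟨e, -⟩ := T.presents_cogen.nonempty_iso h
  exact ⟨e⟩

theorem nonempty_covInj_representable_iso (X : ℰ.ModInj) :
    Nonempty (ℰ.covInj.obj (representable (op X)) ≅ preadditiveCoyoneda.obj (op X)) :=
  ⟨NatIso.ofComponents (fun W => AddEquiv.toAddCommGrpIso
    (X := AddCommGrpCat.of (op W ⟶ op X)) (Y := AddCommGrpCat.of (X ⟶ W))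
    { toFun := Quiver.Hom.unop
      invFun := Quiver.Hom.op
      left_inv := fun _ => rfl
      right_inv := fun _ => rfl
      map_add' := fun _ _ => rfl }) fun _ => rfl⟩

end Extriangulation

end Extri

theorem mainTheorem4 {C : Type u} [Category.{v} C] [Preadditive C] [HasZeroObject C] [HasBinaryBiproducts C]
    (ℰ : Extri.Extriangulation C)
    (hP : ℰ.HasEnoughProjectives) (hI : ℰ.HasEnoughInjectives) :
    -- the equivalences, given by the defects
    (∃ (F : ℰ.STriModR₂ ≌ Extri.FPMod ℰ.ModProj)
        (G : ℰ.STriModR₂ ≌ (Extri.FPMod (ℰ.ModInj)ᵒᵖ)ᵒᵖ)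
        (Φ : Extri.FPMod ℰ.ModProj ≌ (Extri.FPMod (ℰ.ModInj)ᵒᵖ)ᵒᵖ),
      Nonempty (Quotient.functor ℰ.relR₂ ⋙ F.functor ⋙ ℰ.resProj ≅ ℰ.contravariantDefect) ∧
      Nonempty (Quotient.functor ℰ.relR₂ ⋙ G.functor ⋙ ℰ.resInj.op ≅ ℰ.covariantDefect) ∧
      Nonempty (F.functor ⋙ Φ.functor ≅ G.functor)) ∧
    -- the category `mod-(C/[𝒫])`
    (Nonempty (Abelian (Extri.FPMod ℰ.ModProj)) ∧
      EnoughProjectives (Extri.FPMod ℰ.ModProj) ∧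
      EnoughInjectives (Extri.FPMod ℰ.ModProj) ∧
      (∀ X : ℰ.ModProj, ∃ M : Extri.FPMod ℰ.ModProj,
        Projective M ∧ Nonempty (M.obj ≅ preadditiveYoneda.obj X)) ∧
      (∀ M : Extri.FPMod ℰ.ModProj, Projective M →
        ∃ X : ℰ.ModProj, Nonempty (Retract M.obj (preadditiveYoneda.obj X))) ∧
      (IsIdempotentComplete ℰ.ModProj → ∀ M : Extri.FPMod ℰ.ModProj, Projective M →
        ∃ X : ℰ.ModProj, Nonempty (M.obj ≅ preadditiveYoneda.obj X)) ∧
      (∀ X : C, ∃ M : Extri.FPMod ℰ.ModProj,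
        Injective M ∧ Nonempty (ℰ.resProj.obj M ≅ ℰ.E.flip.obj X)) ∧
      (∀ M : Extri.FPMod ℰ.ModProj, Injective M →
        ∃ X : C, Nonempty (Retract (ℰ.resProj.obj M) (ℰ.E.flip.obj X))) ∧
      (IsIdempotentComplete ℰ.ModInj → ∀ M : Extri.FPMod ℰ.ModProj, Injective M →
        ∃ X : C, Nonempty (ℰ.resProj.obj M ≅ ℰ.E.flip.obj X))) ∧
    -- the category `mod-((C/[ℐ])ᵒᵖ)`
    (Nonempty (Abelian (Extri.FPMod (ℰ.ModInj)ᵒᵖ)) ∧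
      EnoughProjectives (Extri.FPMod (ℰ.ModInj)ᵒᵖ) ∧
      EnoughInjectives (Extri.FPMod (ℰ.ModInj)ᵒᵖ) ∧
      (∀ X : ℰ.ModInj, ∃ M : Extri.FPMod (ℰ.ModInj)ᵒᵖ,
        Projective M ∧ Nonempty (ℰ.covInj.obj M ≅ preadditiveCoyoneda.obj (op X))) ∧
      (∀ M : Extri.FPMod (ℰ.ModInj)ᵒᵖ, Projective M →
        ∃ X : ℰ.ModInj, Nonempty (Retract (ℰ.covInj.obj M) (preadditiveCoyoneda.obj (op X)))) ∧
      (IsIdempotentComplete ℰ.ModInj → ∀ M : Extri.FPMod (ℰ.ModInj)ᵒᵖ, Projective M →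
        ∃ X : ℰ.ModInj, Nonempty (ℰ.covInj.obj M ≅ preadditiveCoyoneda.obj (op X))) ∧
      (∀ X : C, ∃ M : Extri.FPMod (ℰ.ModInj)ᵒᵖ,
        Injective M ∧ Nonempty (ℰ.resInj.obj M ≅ ℰ.E.obj (op X))) ∧
      (∀ M : Extri.FPMod (ℰ.ModInj)ᵒᵖ, Injective M →
        ∃ X : C, Nonempty (Retract (ℰ.resInj.obj M) (ℰ.E.obj (op X)))) ∧
      (IsIdempotentComplete ℰ.ModProj → ∀ M : Extri.FPMod (ℰ.ModInj)ᵒᵖ, Injective M →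
        ∃ X : C, Nonempty (ℰ.resInj.obj M ≅ ℰ.E.obj (op X)))) := by
  obtain ⟨F, ⟨eF⟩⟩ := Extri.exists_quotient_equivalence ℰ.relR₂ ℰ.contravariantDefect ℰ.resProj
    Extri.Extriangulation.contravariantDefect_map_eq_iff Extri.Extriangulation.essImage_resProj
    (Extri.Extriangulation.essImage_contravariantDefect hP)
  obtain ⟨G, ⟨eG⟩⟩ := Extri.exists_quotient_equivalence ℰ.relR₂ ℰ.covariantDefect ℰ.resInj.op
    Extri.Extriangulation.covariantDefect_map_eq_iff Extri.Extriangulation.essImage_resInj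
    (Extri.Extriangulation.essImage_covariantDefect hI)
  let Φ : Extri.FPMod ℰ.ModProj ≌ (Extri.FPMod (ℰ.ModInj)ᵒᵖ)ᵒᵖ := F.symm.trans G
  let κ : F.functor ⋙ Φ.functor ≅ G.functor :=
    (Functor.associator _ _ _).symm ≪≫ Functor.isoWhiskerRight F.unitIso.symm _ ≪≫
      Functor.leftUnitor _
  -- One triangle `X ⟶ I ⟶ Z` with `I` injective computes both sides of the duality at once; `h₂`
  -- uses `A ⟶ P ⟶ X` with `P` projective.
  have h₁ : ∀ X : C, ∃ M : Extri.FPMod ℰ.ModProj,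
      Nonempty (Φ.functor.obj M ≅ op (Extri.representable (op (ℰ.injFunctor.obj X)))) ∧
      Nonempty (ℰ.resProj.obj M ≅ ℰ.E.flip.obj X) := by
    intro X
    obtain ⟨I, Z, x, y, δ, h, hII⟩ := hI X
    let T : ℰ.STri := ⟨x, y, δ, h⟩
    obtain ⟨e₁⟩ := Extri.Extriangulation.nonempty_contravariantDefect_iso_ext T hII
    obtain ⟨e₂⟩ := Extri.Extriangulation.nonempty_covariantDefect_iso_representable T hII
    exact ⟨F.functor.obj ⟨T⟩, ⟨κ.app ⟨T⟩ ≪≫ ℰ.resInj.op.preimageIso (eG.app T ≪≫ e₂.op.symm)⟩,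
      ⟨eF.app T ≪≫ e₁⟩⟩
  have h₂ : ∀ X : C, ∃ N : Extri.FPMod (ℰ.ModInj)ᵒᵖ,
      Nonempty (Φ.symm.rightOp.functor.obj N ≅
        op (Extri.representable (ℰ.projFunctor.obj X))) ∧
      Nonempty (ℰ.resInj.obj N ≅ ℰ.E.obj (op X)) := by
    intro X
    obtain ⟨A, P, x, y, δ, h, hPP⟩ := hP X
    let T : ℰ.STri := ⟨x, y, δ, h⟩
    obtain ⟨e₁⟩ := Extri.Extriangulation.nonempty_covariantDefect_iso_ext T hPP
    obtain ⟨e₂⟩ := Extri.Extriangulation.nonempty_contravariantDefect_iso_representable T hPP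
    let i : F.functor.obj ⟨T⟩ ≅ Extri.representable (ℰ.projFunctor.obj X) :=
      ℰ.resProj.preimageIso (eF.app T ≪≫ e₂)
    let j : Φ.inverse.obj (G.functor.obj ⟨T⟩) ≅ F.functor.obj ⟨T⟩ :=
      Φ.inverse.mapIso (κ.app ⟨T⟩).symm ≪≫ (Φ.unitIso.app _).symm
    exact ⟨(G.functor.obj ⟨T⟩).unop, ⟨(j ≪≫ i).symm.op⟩, ⟨(eG.app T).unop.symm ≪≫ e₁⟩⟩
  choose M eM hM using h₁
  choose N eN hN using h₂
  obtain ⟨ei₁, inj₁, ret₁, iso₁⟩ := Extri.injectives_of_duality Φ (fun Y => M Y.unop.as)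
    fun Y => eM Y.unop.as
  obtain ⟨ei₂, inj₂, ret₂, iso₂⟩ := Extri.injectives_of_duality Φ.symm.rightOp (fun Y => N Y.as)
    fun Y => eN Y.as
  refine ⟨⟨F, G, Φ, ⟨eF⟩, ⟨eG⟩, ⟨κ⟩⟩,
    ⟨Extri.nonempty_abelian (Extri.Extriangulation.hasWeakKernels_modProj hP),
      Extri.enoughProjectives_FPMod, ei₁,
      fun X => ⟨Extri.representable X, Extri.projective_representable X, ⟨Iso.refl _⟩⟩,
      fun K hK => ?_, fun hD K hK => ?_, fun X => ⟨M X, inj₁ (op ⟨X⟩), hM X⟩,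
      fun K hK => ?_, fun hD K hK => ?_⟩,
    ⟨Extri.nonempty_abelian (Extri.Extriangulation.hasWeakKernels_modInj hI),
      Extri.enoughProjectives_FPMod, ei₂,
      fun X => ⟨Extri.representable (op X), Extri.projective_representable (op X),
        Extri.Extriangulation.nonempty_covInj_representable_iso X⟩,
      fun K hK => ?_, fun hD K hK => ?_, fun X => ⟨N X, inj₂ ⟨X⟩, hN X⟩,
      fun K hK => ?_, fun hD K hK => ?_⟩⟩
  · obtain ⟨Y, ⟨r⟩⟩ := Extri.exists_retract_representable K
    exact ⟨Y, ⟨r.map (Extri.isFinitelyPresented _).ι⟩⟩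
  · obtain ⟨Y, ⟨r⟩⟩ := Extri.exists_iso_representable K
    exact ⟨Y, ⟨(Extri.isFinitelyPresented _).ι.mapIso r⟩⟩
  · obtain ⟨Y, ⟨r⟩⟩ := ret₁ K hK
    obtain ⟨i⟩ := hM Y.unop.as
    exact ⟨_, ⟨(r.map ℰ.resProj).trans (.ofIso i)⟩⟩
  -- The duality involves modules over `(C/[ℐ])ᵒᵖ`; idempotent completeness passes to the opposite
  -- category.
  · obtain ⟨Y, ⟨r⟩⟩ := iso₁ inferInstance K hK
    obtain ⟨i⟩ := hM Y.unop.as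
    exact ⟨_, ⟨ℰ.resProj.mapIso r ≪≫ i⟩⟩
  · obtain ⟨⟨Y⟩, ⟨r⟩⟩ := Extri.exists_retract_representable K
    obtain ⟨i⟩ := Extri.Extriangulation.nonempty_covInj_representable_iso Y
    exact ⟨Y, ⟨(r.map ℰ.covInj).trans (.ofIso i)⟩⟩
  · obtain ⟨⟨Y⟩, ⟨r⟩⟩ := Extri.exists_iso_representable K
    obtain ⟨i⟩ := Extri.Extriangulation.nonempty_covInj_representable_iso Y
    exact ⟨Y, ⟨ℰ.covInj.mapIso r ≪≫ i⟩⟩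
  · obtain ⟨Y, ⟨r⟩⟩ := ret₂ K hK
    obtain ⟨i⟩ := hN Y.as
    exact ⟨_, ⟨(r.map ℰ.resInj).trans (.ofIso i)⟩⟩
  · obtain ⟨Y, ⟨r⟩⟩ := iso₂ hD K hK
    obtain ⟨i⟩ := hN Y.as
    exact ⟨_, ⟨ℰ.resInj.mapIso r ≪≫ i⟩⟩
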